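/- **Setting.** Consider a spin chain with $L$ sites, free or periodic boundary conditions, local dimension $d$, Hilbert space $(\mathbb C^d)^{\otimes L}$, and let $\operatorname{dist}$ be the distance of sites on the chain. An operator is *localised* on a set $X$ of sites if it has the form $M_X\otimes 1$. An operator $A$ is *quasilocalised* about $Z$ with amplitude $K$ and decay length $\mu$ if for every integer $r\ge 0$ there is an operator $B$, localised on the set of sites at distance at most $r$ from $Z$, with $\|A-B\|\le K e^{-r/\mu}$ (operator norm). *Hamiltonians.* A Hermitian operator $H$ is *quasilocal* (with constants $J,\mu>0$) if for every site $i$ and every operator $O$ localised on $\{i\}$, $i[H,O]$ has norm at most $J\|O\|$ and is quasilocalised about $\{i\}$ with amplitude $J\|O\|$ and decay length $\mu$. A Hermitian $H=\sum_\ell h_\ell$ has *quasilocal energy density* $(h_\ell)$ if for every site $\ell$, $\|h_\ell\|\le J$ and $h_\ell$ is quasilocalised about $\{\ell\}$ with amplitude $J$ and decay length $\mu$. The $h_\ell$ at different sites are unrelated (no translation invariance), and nothing is assumed about criticality. *States.* Write $\langle A\rangle=\langle\Psi|A|\Psi\rangle$ for a unit vector $\Psi$ and $\langle A;B\rangle=\langle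 AB\rangle-\langle A\rangle\langle B\rangle$. The state $\Psi$ has *finite correlation length* $\xi>0$ (with constants $c,a$) if for all $A$ localised on $X$ and $B$ localised on $Y$ with $\operatorname{dist}(X,Y)\ge r$, $r\in\mathbb N$, $$|\langle A;B\rangle|\le c\,e^{a(|X|+|Y|)}\,\|A\|\,\|B\|\,e^{-r/\xi}.$$ For an operator $H$ put $\kappa_n(H)=\partial_t^n\big|_{t=0}\log\langle e^{tH}\rangle$ (the $n$-th energy cumulant) and $H^{(n)}=\partial_\beta^n\big|_{\beta=0}\frac{e^{\beta H}-1}{\langle e^{\beta H}\rangle}$; for a set $S$ of sites put $H_S=\sum_{\ell\in S}h_\ell$ and let $H_S^{(n)}$ be the same expression with $H_S$ in place of $H$ and the same state $\Psi$. **Statement.** Fix $d,J,\mu,c,a,\xi$ with $\mu,\xi>0$. In each of the following, the constants $K,\kappa$ depend only on these six numbers and on the indices displayed before them; in particular they do not depend on $L$, the boundary conditions, the Hamiltonian or the state (of finite correlation length $\xi$, with constants $c,a$). 1. (Extensivity, quasilocal Hamiltonians.) For every $n$ there is $K$ such that for every quasilocal $H$: $|\kappa_n(H)|\le K L$ if $n\ne1$,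 and $|\kappa_1(H)-d^{-L}\operatorname{tr}H|\le KL$. (A constant added to $H$ changes only $\kappa_1$.) 2. (Extensivity, energy densities.) For every $n$ there is $K$ such that for every $H=\sum_\ell h_\ell$ with quasilocal energy density, $|\kappa_n(H)|\le K L$. 3. (Cumulant densities.) For every $n\ge1$ there is $K$ such that for every $H=\sum_\ell h_\ell$ with quasilocal energy density, $\kappa_{n+1}(H)=\sum_\ell\langle H^{(n)};h_\ell\rangle$ and $|\langle H^{(n)};h_\ell\rangle|\le K$ for every site $\ell$. 4. (Lemma 1.) For every $n$ there is $\kappa>0$ such that for every $k\in\mathbb N$ there is $K$ such that for every $H=\sum_\ell h_\ell$ with quasilocal energy density, every operator $O$ localised on a set $Z$ of at most $k$ sites, every integer $r\ge0$ and every set $S$ containing all sites at distance at most $r$ from $Z$, $$\big|\langle H^{(n)};O\rangle-\langle H_S^{(n)};O\rangle\big|\le K\,\|O\|\,e^{-\kappa r}.$$ 5. (Quasilocalisation.) For all $n,k$ there is $K$ such that for every $H=\sum_\ell h_\ell$ with quasilocal energy density and every set $S$ of at most $k$ sites, $H_S^{(n)}$ is quasilocalised about $S$ with amplitude $K$ and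 decay length $\mu$. -/

import Mathlib

open scoped Matrix Matrix.Norms.L2Operator

noncomputable section

namespace SpinChain

/-- Boundary conditions of a finite chain. -/
inductive Boundary where
  | free
  | periodic

/-- The distance between two sites of a chain with `L` sites. -/
def siteDist (b : Boundary) {L : ℕ} (i j : Fin L) : ℕ :=
  match b with
  | Boundary.free => ((i : ℤ) - (j : ℤ)).natAbs
  | Boundary.periodic => min ((i : ℤ) - (j : ℤ)).natAbs (L - ((i : ℤ) - (j : ℤ)).natAbs)

open Classical in
/-- The set of sites within distance `r` of the set `Z`. -/
def thicken (b : Boundary) {L : ℕ} (Z : Finset (Fin L)) (r : ℕ) : Finset (Fin L) :=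
  Finset.univ.filter fun i => ∃ j ∈ Z, siteDist b i j ≤ r

/-- Spin configurations: the product basis of the Hilbert space `(ℂ^d)^{⊗ L}`. -/
abbrev Config (L d : ℕ) : Type := Fin L → Fin d

/-- Operators on `(ℂ^d)^{⊗ L}`, as matrices in the product basis; `‖A‖` is the operator norm
(the `ℓ²` operator norm of the matrix). -/
abbrev Op (L d : ℕ) : Type := Matrix (Config L d) (Config L d) ℂ

/-- State vectors, by their coordinates in the product basis. -/
abbrev StateVec (L d : ℕ) : Type := Config L d → ℂ

/-- `A` is localised on `X`: it equals `M ⊗ 1`, where `M` acts on the sites of `X` and `1` on all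
the other sites. -/
def LocalisedOn {L d : ℕ} (X : Finset (Fin L)) (A : Op L d) : Prop :=
  ∃ M : Matrix (X → Fin d) (X → Fin d) ℂ,
    (∀ σ τ : Config L d, (∀ i, i ∉ X → σ i = τ i) →
      A σ τ = M (fun i => σ i) (fun i => τ i)) ∧
    (∀ σ τ : Config L d, (∃ i, i ∉ X ∧ σ i ≠ τ i) → A σ τ = 0)

/-- The expectation value `⟨ψ|A|ψ⟩`. -/
def expect {L d : ℕ} (ψ : StateVec L d) (A : Op L d) : ℂ := star ψ ⬝ᵥ (A *ᵥ ψ)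

/-- The connected correlation `⟨A B⟩ - ⟨A⟩⟨B⟩`. -/
def connCorr {L d : ℕ} (ψ : StateVec L d) (A B : Op L d) : ℂ :=
  expect ψ (A * B) - expect ψ A * expect ψ B

/-- `A` is quasilocalised about the set `Z`, with amplitude `K` and decay length `μ`: for every `r`
it is approximated, up to `K e^{-r/μ}`, by an operator localised on the `r`-neighbourhood of `Z`. -/
def QuasilocalisedAbout (b : Boundary) {L d : ℕ} (K μ : ℝ) (Z : Finset (Fin L))
    (A : Op L d) : Prop :=
  ∀ r : ℕ, ∃ B : Op L d, LocalisedOn (thicken b Z r) B ∧ ‖A - B‖ ≤ K * Real.exp (-(r : ℝ) / μ)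

/-- `H` is a quasilocal Hamiltonian: it is Hermitian and `i[H, O]` is bounded and quasilocalised about
the support of `O`, uniformly in the position of `O`. The condition is only imposed for operators `O`
on a single site, which generate all localised operators. -/
structure IsQuasilocal (b : Boundary) {L d : ℕ} (J μ : ℝ) (H : Op L d) : Prop where
  hermitian : H.IsHermitian
  bounded : ∀ (i : Fin L) (O : Op L d), LocalisedOn {i} O →
    ‖Complex.I • (H * O - O * H)‖ ≤ J * ‖O‖
  quasilocalised : ∀ (i : Fin L) (O : Op L d), LocalisedOn {i} O →
    QuasilocalisedAbout b (J * ‖O‖) μ {i} (Complex.I • (H * O - O * H))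

/-- `h` is the energy density of a quasilocal Hamiltonian `∑ ℓ, h ℓ`: the sum is Hermitian and every
`h ℓ` is bounded by `J` and quasilocalised about the site `ℓ`. No relation between the `h ℓ` at
different sites is required. -/
structure IsQuasilocalDensity (b : Boundary) {L d : ℕ} (J μ : ℝ) (h : Fin L → Op L d) : Prop where
  hermitian : (∑ l, h l).IsHermitian
  bounded : ∀ l, ‖h l‖ ≤ J
  quasilocalised : ∀ l, QuasilocalisedAbout b J μ {l} (h l)

/-- `ψ` is a normalised state with finite correlation length `ξ`: connected correlations of localised
operators decay as `e^{-r/ξ}` with the distance `r` of the supports, with a prefactor that grows at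
most exponentially with the sizes of the supports (a uniform or a polynomially growing prefactor is
a special case). -/
structure HasCorrelationLength (b : Boundary) {L d : ℕ} (c a ξ : ℝ) (ψ : StateVec L d) : Prop where
  normalised : star ψ ⬝ᵥ ψ = 1
  decay : ∀ (X Y : Finset (Fin L)) (A B : Op L d) (r : ℕ),
    LocalisedOn X A → LocalisedOn Y B → (∀ i ∈ X, ∀ j ∈ Y, r ≤ siteDist b i j) →
    ‖connCorr ψ A B‖ ≤
      c * Real.exp (a * ((X.card : ℝ) + Y.card)) * ‖A‖ * ‖B‖ * Real.exp (-(r : ℝ) / ξ)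

/-- The `n`-th energy cumulant `∂ₜⁿ log ⟨ψ|e^{tH}|ψ⟩` at `t = 0`. -/
def cumulant {L d : ℕ} (ψ : StateVec L d) (H : Op L d) (n : ℕ) : ℂ :=
  iteratedDeriv n (fun t : ℝ => Complex.log (expect ψ (NormedSpace.exp ((t : ℂ) • H)))) 0

/-- `H^{(n)} = ∂_βⁿ ((e^{βH} - 1) / ⟨ψ|e^{βH}|ψ⟩)` at `β = 0`. -/
def dressed {L d : ℕ} (ψ : StateVec L d) (H : Op L d) (n : ℕ) : Op L d :=
  iteratedDeriv n (fun β : ℝ => (expect ψ (NormedSpace.exp ((β : ℂ) • H)))⁻¹ •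
    (NormedSpace.exp ((β : ℂ) • H) - 1)) 0

/-- The truncated Hamiltonian `H_S = ∑_{ℓ ∈ S} h_ℓ`. The full Hamiltonian is `hamiltonian h univ`. -/
def hamiltonian {L d : ℕ} (h : Fin L → Op L d) (S : Finset (Fin L)) : Op L d := ∑ l ∈ S, h l

end SpinChain

end

namespace SpinChain

variable {L d : ℕ}

/-! ### Expectation values -/

/-! Everything reduces to the derivatives at β = 0 of ⟨e^{βH} O⟩ / ⟨e^{βH}⟩, called `ratioDeriv`.
The logarithmic derivative of ⟨e^{βH}⟩ is this ratio with O = H (`cumulant_succ`), and for n ≥ 1 the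
correlation ⟨H^{(n)}; O⟩ is the n-th derivative of the ratio itself (`connCorr_dressed`). Since the
ratio is linear in O, it suffices to bound it, uniformly in L, for O approximately localised near a
bounded set Z.

Expanding powers of H = ∑ h_ℓ gives a sum over words of sites. Dividing by ⟨e^{βH}⟩ replaces the
expectation of a word by its connected part with respect to the shuffle product; the order of the
noncommuting letters is kept (`ratioDeriv_eq_wordSum`). If the expectations factorise approximately
between the letters near Z and those far from it, the connected part of a word with a far letter is
approximately zero (`exists_norm_connected_sub_le`).

Factorisation comes from the finite correlation length. A word of n letters, one of them far from Z,
leaves some wide annulus around Z empty (`exists_empty_annulus`). Replacing each h_ℓ by a localised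
approximant of range t, with t a small fraction of the width, separates the two groups of letters.
The prefactor, exponential in the support sizes and hence in t, is beaten by the decay across the
annulus (`exists_norm_wordExpect_sub_le`). So connected parts decay exponentially with the distance
of the farthest letter (`exists_norm_connected_wordExpect_le`). Sharing this decay among the letters
makes the sum over words converge independently of L, and words leaving S are exponentially small
(`exists_norm_ratioDeriv_le`).

A quasilocal Hamiltonian without a given density is reduced to this case by averaging over the sites
one after the other. The increments form an energy density, because each is built from commutators
of H with operators at one site (`averageDensity_eq`). Quasilocalisation of H_S^{(n)} is separate:
it is a polynomial in H_S with bounded coefficients (`dressed_eq_sum`). -/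

/-- The expectation value as a linear map. -/
noncomputable def expectLin (ψ : StateVec L d) : Op L d →ₗ[ℂ] ℂ where
  toFun := expect ψ
  map_add' A B := by simp [expect, Matrix.add_mulVec, dotProduct_add]
  map_smul' z A := by simp [expect, Matrix.smul_mulVec, dotProduct_smul]

/-- The expectation value as a continuous real-linear map. -/
noncomputable def expectCLM (ψ : StateVec L d) : Op L d →L[ℝ] ℂ :=
  (LinearMap.toContinuousLinearMap (expectLin ψ)).restrictScalars ℝ

@[simp] lemma expectCLM_apply (ψ : StateVec L d) (A : Op L d) : expectCLM ψ A = expect ψ A := rfl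

lemma expect_add (ψ : StateVec L d) (A B : Op L d) :
    expect ψ (A + B) = expect ψ A + expect ψ B := (expectLin ψ).map_add A B

lemma expect_sub (ψ : StateVec L d) (A B : Op L d) :
    expect ψ (A - B) = expect ψ A - expect ψ B := (expectLin ψ).map_sub A B

lemma expect_smul (ψ : StateVec L d) (z : ℂ) (A : Op L d) :
    expect ψ (z • A) = z * expect ψ A := (expectLin ψ).map_smul z A

lemma expect_sum {ι : Type*} (ψ : StateVec L d) (s : Finset ι) (f : ι → Op L d) :
    expect ψ (∑ i ∈ s, f i) = ∑ i ∈ s, expect ψ (f i) := map_sum (expectLin ψ) f s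

lemma expect_one {ψ : StateVec L d} (hψ : star ψ ⬝ᵥ ψ = 1) : expect ψ (1 : Op L d) = 1 := by
  simp [expect, hψ]

lemma norm_expect_le {ψ : StateVec L d} (hψ : star ψ ⬝ᵥ ψ = 1) (A : Op L d) :
    ‖expect ψ A‖ ≤ ‖A‖ := by
  set x : EuclideanSpace ℂ (Config L d) := WithLp.toLp 2 ψ with hx
  have h1 : expect ψ A = inner ℂ x (WithLp.toLp 2 (A *ᵥ ψ)) := by
    rw [EuclideanSpace.inner_eq_star_dotProduct]
    simp [expect, hx, dotProduct_comm]
  have hn : ‖x‖ = 1 := by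
    have h2 : inner ℂ x x = (1 : ℂ) := by
      rw [EuclideanSpace.inner_eq_star_dotProduct, dotProduct_comm]
      simpa [hx] using hψ
    have h3 := inner_self_eq_norm_sq_to_K (𝕜 := ℂ) x
    rw [h2] at h3
    have h4 : ‖x‖ ^ 2 = 1 := by
      have h5 : ((‖x‖ ^ 2 : ℝ) : ℂ) = 1 := by simpa using h3.symm
      exact_mod_cast h5
    nlinarith [norm_nonneg x]
  have h2 : ‖(WithLp.toLp 2 (A *ᵥ ψ) : EuclideanSpace ℂ (Config L d))‖ ≤ ‖A‖ * ‖x‖ :=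
    Matrix.l2_opNorm_mulVec A x
  rw [h1]
  calc _ ≤ ‖x‖ * ‖(WithLp.toLp 2 (A *ᵥ ψ) : EuclideanSpace ℂ (Config L d))‖ := norm_inner_le_norm _ _
    _ ≤ ‖A‖ := by rw [hn] at h2 ⊢; linarith

lemma nonempty_config {ψ : StateVec L d} (hψ : star ψ ⬝ᵥ ψ = 1) : Nonempty (Config L d) := by
  by_contra h
  rw [not_nonempty_iff] at h
  simp [dotProduct] at hψ

lemma norm_one_le (L d : ℕ) : ‖(1 : Op L d)‖ ≤ 1 := by
  rcases isEmpty_or_nonempty (Config L d) with h | h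
  · rw [Subsingleton.elim (1 : Op L d) 0]; simp
  · exact (CStarRing.norm_one).le

/-! ### Generating functions -/

lemma hasDerivAt_exp_ofReal_smul (H O : Op L d) (t : ℝ) :
    HasDerivAt (fun t : ℝ => NormedSpace.exp ((t : ℂ) • H) * O)
      (NormedSpace.exp ((t : ℂ) • H) * (H * O)) t := by
  have h := (hasDerivAt_exp_smul_const (𝕂 := ℝ) H t).mul_const O
  simp only [Complex.coe_smul, ← mul_assoc]
  exact h

lemma iteratedDeriv_exp_ofReal_smul (H O : Op L d) (n : ℕ) :
    iteratedDeriv n (fun t : ℝ => NormedSpace.exp ((t : ℂ) • H) * O) =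
      fun t : ℝ => NormedSpace.exp ((t : ℂ) • H) * (H ^ n * O) := by
  induction n with
  | zero => simp
  | succ n ih =>
    rw [iteratedDeriv_succ, ih]
    funext t
    rw [(hasDerivAt_exp_ofReal_smul H _ t).deriv, pow_succ', mul_assoc]

lemma contDiff_exp_ofReal_smul_mul (H O : Op L d) (n : ℕ) :
    ContDiff ℝ n (fun t : ℝ => NormedSpace.exp ((t : ℂ) • H) * O) := by
  refine contDiff_of_differentiable_iteratedDeriv fun m _ => ?_
  rw [iteratedDeriv_exp_ofReal_smul]
  exact fun t => (hasDerivAt_exp_ofReal_smul H _ t).differentiableAt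

lemma iteratedDeriv_clm_comp {E F : Type*} [NormedAddCommGroup E] [NormedSpace ℝ E]
    [NormedAddCommGroup F] [NormedSpace ℝ F] (φ : E →L[ℝ] F) {f : ℝ → E} {n : ℕ} {x : ℝ}
    (hf : ContDiffAt ℝ n f x) :
    iteratedDeriv n (fun t => φ (f t)) x = φ (iteratedDeriv n f x) := by
  have h := φ.iteratedFDeriv_comp_left hf (i := n) le_rfl
  simp only [iteratedDeriv_eq_iteratedFDeriv]
  change iteratedFDeriv ℝ n (φ ∘ f) x _ = _
  rw [h]; rfl

/-- The function `β ↦ ⟨e^{βH} O⟩`. -/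
noncomputable def genNum (ψ : StateVec L d) (H O : Op L d) (β : ℝ) : ℂ :=
  expect ψ (NormedSpace.exp ((β : ℂ) • H) * O)

/-- The function `β ↦ ⟨e^{βH}⟩`. -/
noncomputable def genZ (ψ : StateVec L d) (H : Op L d) (β : ℝ) : ℂ :=
  expect ψ (NormedSpace.exp ((β : ℂ) • H))

/-- The `n`-th derivative of `⟨e^{βH} O⟩ / ⟨e^{βH}⟩` at `β = 0`. -/
noncomputable def ratioDeriv (ψ : StateVec L d) (H O : Op L d) (n : ℕ) : ℂ :=
  iteratedDeriv n (fun β => (genZ ψ H β)⁻¹ * genNum ψ H O β) 0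

lemma genZ_eq_genNum (ψ : StateVec L d) (H : Op L d) : genZ ψ H = genNum ψ H 1 := by
  funext β; simp [genZ, genNum]

lemma contDiff_genNum (ψ : StateVec L d) (H O : Op L d) (n : ℕ) :
    ContDiff ℝ n (genNum ψ H O) :=
  (expectCLM ψ).contDiff.comp (contDiff_exp_ofReal_smul_mul H O n)

lemma contDiff_genZ (ψ : StateVec L d) (H : Op L d) (n : ℕ) : ContDiff ℝ n (genZ ψ H) := by
  rw [genZ_eq_genNum]; exact contDiff_genNum ψ H 1 n

lemma iteratedDeriv_genNum (ψ : StateVec L d) (H O : Op L d) (n : ℕ) :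
    iteratedDeriv n (genNum ψ H O) 0 = expect ψ (H ^ n * O) := by
  have h := iteratedDeriv_clm_comp (expectCLM ψ)
    (contDiff_exp_ofReal_smul_mul H O n).contDiffAt (x := 0)
  rw [iteratedDeriv_exp_ofReal_smul] at h
  simp only [expectCLM_apply, Complex.ofReal_zero, zero_smul, NormedSpace.exp_zero, one_mul] at h
  exact h

lemma hasDerivAt_genNum (ψ : StateVec L d) (H O : Op L d) (t : ℝ) :
    HasDerivAt (genNum ψ H O) (genNum ψ H (H * O) t) t :=
  (expectCLM ψ).hasFDerivAt.comp_hasDerivAt t (hasDerivAt_exp_ofReal_smul H O t)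

section Normalised

variable {ψ : StateVec L d} (hψ : star ψ ⬝ᵥ ψ = 1)
include hψ

lemma genZ_zero (H : Op L d) : genZ ψ H 0 = 1 := by simp [genZ, expect_one hψ]

/-- The value at β = 0 is 1, so continuity suffices. Near 0 this makes the logarithm differentiable
and the division legitimate; derivatives at 0 need no more. -/
lemma eventually_genZ_mem_slitPlane (H : Op L d) :
    ∀ᶠ β in nhds (0 : ℝ), genZ ψ H β ∈ Complex.slitPlane := by
  have hc : ContinuousAt (genZ ψ H) 0 := (contDiff_genZ ψ H 0).continuous.continuousAt
  refine hc.eventually_mem (Complex.isOpen_slitPlane.mem_nhds ?_)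
  rw [genZ_zero hψ]; exact Complex.one_mem_slitPlane

lemma contDiffAt_genZ_inv (H : Op L d) (n : ℕ) :
    ContDiffAt ℝ n (fun β => (genZ ψ H β)⁻¹) 0 :=
  (contDiff_genZ ψ H n).contDiffAt.inv (by rw [genZ_zero hψ]; exact one_ne_zero)

lemma sum_choose_mul_ratioDeriv (H O : Op L d) (n : ℕ) :
    ∑ i ∈ Finset.range (n + 1), (n.choose i : ℂ) * expect ψ (H ^ i) * ratioDeriv ψ H O (n - i) =
      expect ψ (H ^ n * O) := by
  rw [← iteratedDeriv_genNum]
  have h : genNum ψ H O =ᶠ[nhds 0]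
      fun β => genZ ψ H β * ((genZ ψ H β)⁻¹ * genNum ψ H O β) := by
    filter_upwards [eventually_genZ_mem_slitPlane hψ H] with β hβ
    rw [mul_inv_cancel_left₀ (Complex.slitPlane_ne_zero hβ)]
  rw [h.iteratedDeriv_eq n, iteratedDeriv_fun_mul (contDiff_genZ ψ H n).contDiffAt
    ((contDiffAt_genZ_inv hψ H n).mul (contDiff_genNum ψ H O n).contDiffAt)]
  refine Finset.sum_congr rfl fun i _ => ?_
  rw [genZ_eq_genNum, iteratedDeriv_genNum, mul_one, ← genZ_eq_genNum]
  rfl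

/-- The Leibniz identity solved for its leading term, whose coefficient is ⟨1⟩ = 1. This recursion
determines all the derivatives from the moments. -/
lemma ratioDeriv_succ_eq (H O : Op L d) (n : ℕ) :
    ratioDeriv ψ H O n = expect ψ (H ^ n * O) -
      ∑ i ∈ Finset.range n, (n.choose (i + 1) : ℂ) * expect ψ (H ^ (i + 1)) *
        ratioDeriv ψ H O (n - (i + 1)) := by
  rw [← sum_choose_mul_ratioDeriv hψ, Finset.sum_range_succ']
  simp [expect_one hψ]

lemma ratioDeriv_sum {ι : Type*} (H : Op L d) (s : Finset ι) (O : ι → Op L d) (n : ℕ) :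
    ratioDeriv ψ H (∑ i ∈ s, O i) n = ∑ i ∈ s, ratioDeriv ψ H (O i) n := by
  have h : (fun β => (genZ ψ H β)⁻¹ * genNum ψ H (∑ i ∈ s, O i) β) =
      fun β => ∑ i ∈ s, (genZ ψ H β)⁻¹ * genNum ψ H (O i) β := by
    funext β
    simp [genNum, Finset.mul_sum, expect_sum]
  rw [ratioDeriv, h, iteratedDeriv_fun_sum]
  · rfl
  · exact fun i _ => (contDiffAt_genZ_inv hψ H n).mul (contDiff_genNum ψ H _ n).contDiffAt

lemma ratioDeriv_smul_one (H : Op L d) (z : ℂ) (n : ℕ) :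
    ratioDeriv ψ H (z • 1) n = if n = 0 then z else 0 := by
  have h : (fun β => (genZ ψ H β)⁻¹ * genNum ψ H (z • 1) β) =ᶠ[nhds 0] fun _ => z := by
    filter_upwards [eventually_genZ_mem_slitPlane hψ H] with β hβ
    have : genNum ψ H (z • 1) β = z * genZ ψ H β := by simp [genNum, genZ, expect_smul]
    rw [this, mul_comm z, inv_mul_cancel_left₀ (Complex.slitPlane_ne_zero hβ)]
  rw [ratioDeriv, h.iteratedDeriv_eq, iteratedDeriv_const]

lemma ratioDeriv_add (H O O' : Op L d) (n : ℕ) :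
    ratioDeriv ψ H (O + O') n = ratioDeriv ψ H O n + ratioDeriv ψ H O' n := by
  simpa using ratioDeriv_sum hψ H Finset.univ ![O, O'] n

lemma cumulant_zero (H : Op L d) : cumulant ψ H 0 = 0 := by
  have := genZ_zero hψ H
  simp only [genZ] at this
  simp [cumulant, expect_one hψ]

lemma cumulant_succ (H : Op L d) (n : ℕ) : cumulant ψ H (n + 1) = ratioDeriv ψ H H n := by
  rw [cumulant, iteratedDeriv_succ', ratioDeriv]
  refine Filter.EventuallyEq.iteratedDeriv_eq n ?_
  filter_upwards [eventually_genZ_mem_slitPlane hψ H] with β hβ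
  have h1 : HasDerivAt (genZ ψ H) (genNum ψ H H β) β := by
    have := hasDerivAt_genNum ψ H 1 β
    rwa [mul_one, ← genZ_eq_genNum] at this
  have h2 := h1.clog_real hβ
  rw [div_eq_inv_mul] at h2
  exact h2.deriv

/-- Before differentiation, the two terms ⟨O⟩ produced by the `- 1` cancel, and what remains is
⟨e^{βH} O⟩ / ⟨e^{βH}⟩ - ⟨O⟩. The constant matters only for n = 0. -/
lemma connCorr_dressed (H O : Op L d) (n : ℕ) :
    connCorr ψ (dressed ψ H n) O = if n = 0 then 0 else ratioDeriv ψ H O n := by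
  have hE : ContDiff ℝ n (fun t : ℝ => NormedSpace.exp ((t : ℂ) • H) - 1) := by
    have := contDiff_exp_ofReal_smul_mul H 1 n
    simp only [mul_one] at this
    exact this.sub contDiff_const
  have hF : ContDiffAt ℝ n (fun β : ℝ => (expect ψ (NormedSpace.exp ((β : ℂ) • H)))⁻¹ •
      (NormedSpace.exp ((β : ℂ) • H) - 1)) 0 :=
    (contDiffAt_genZ_inv hψ H n).smul hE.contDiffAt
  let φ : Op L d →L[ℝ] ℂ := (LinearMap.toContinuousLinearMap
    ((expectLin ψ).comp (LinearMap.mulRight ℂ O) - expect ψ O • expectLin ψ)).restrictScalars ℝ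
  have hφ : ∀ A, φ A = connCorr ψ A O := fun A => by
    change expect ψ (A * O) - expect ψ O * expect ψ A = _
    rw [connCorr, mul_comm (expect ψ O)]
  rw [← hφ, dressed, ← iteratedDeriv_clm_comp φ hF]
  have hev : (fun β : ℝ => φ ((expect ψ (NormedSpace.exp ((β : ℂ) • H)))⁻¹ •
      (NormedSpace.exp ((β : ℂ) • H) - 1))) =ᶠ[nhds 0]
      fun β => (genZ ψ H β)⁻¹ * genNum ψ H (O + (-expect ψ O) • 1) β := by
    filter_upwards [eventually_genZ_mem_slitPlane hψ H] with β hβ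
    have hz := Complex.slitPlane_ne_zero hβ
    simp only [hφ, connCorr, genNum, smul_mul_assoc, expect_smul, sub_mul, expect_sub, one_mul,
      mul_add, expect_add, mul_smul_comm, mul_one, expect_one hψ]
    rw [genZ] at hz ⊢
    field_simp
    ring
  rw [hev.iteratedDeriv_eq]
  change ratioDeriv ψ H _ n = _
  rw [ratioDeriv_add hψ, ratioDeriv_smul_one hψ]
  rcases Nat.eq_zero_or_pos n with rfl | hn
  · have := ratioDeriv_succ_eq hψ H O 0
    simp at this
    simp [this]
  · simp [hn.ne']

-- The shift multiplies numerator and denominator by the same factor e^{βz}.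
omit hψ in
lemma ratioDeriv_add_smul_one (H O : Op L d) (z : ℂ) (n : ℕ) :
    ratioDeriv ψ (H + z • 1) O n = ratioDeriv ψ H O n := by
  have hexp : ∀ β : ℝ, NormedSpace.exp ((β : ℂ) • (H + z • (1 : Op L d))) =
      Complex.exp (β * z) • NormedSpace.exp ((β : ℂ) • H) := fun β => by
    have hc : Commute ((β : ℂ) • H) ((β * z) • (1 : Op L d)) :=
      (Commute.one_right _).smul_right _
    have h1 : NormedSpace.exp (((β : ℂ) * z) • (1 : Op L d)) =
        Complex.exp (β * z) • (1 : Op L d) := by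
      have := NormedSpace.algebraMap_exp_comm (𝕂 := ℂ) (𝔸 := Op L d) ((β : ℂ) * z)
      rw [Algebra.algebraMap_eq_smul_one, Algebra.algebraMap_eq_smul_one] at this
      rw [← this, Complex.exp_eq_exp_ℂ]
    rw [smul_add, smul_smul, Matrix.exp_add_of_commute _ _ hc, h1, mul_smul_comm, mul_one]
  unfold ratioDeriv
  congr 1
  funext β
  have h0 := Complex.exp_ne_zero (β * z)
  simp only [genZ, genNum, hexp, smul_mul_assoc, expect_smul]
  rw [mul_inv, mul_mul_mul_comm, inv_mul_cancel₀ h0, one_mul]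

lemma cumulant_add_smul_one (H : Op L d) (z : ℂ) (n : ℕ) :
    cumulant ψ (H + z • 1) n - (if n = 1 then z else 0) = cumulant ψ H n := by
  rcases n with _ | n
  · simp [cumulant_zero hψ]
  · rw [cumulant_succ hψ, cumulant_succ hψ, ratioDeriv_add_smul_one, ratioDeriv_add hψ,
      ratioDeriv_smul_one hψ]
    simp

end Normalised

/-! ### Words and the shuffle product -/

section Words

variable {α : Type*}

/-- All ways to split a word into two complementary subwords. -/
def splits : List α → List (List α × List α)
  | [] => [([], [])]
  | a :: w => (splits w).map (fun q => (q.1, a :: q.2)) ++ (splits w).map (fun q => (a :: q.1, q.2))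

/-- The sum of `F x y` over all splittings of a word into complementary subwords `x` and `y`. -/
def splitSum (F : List α → List α → ℂ) (w : List α) : ℂ := ((splits w).map fun q => F q.1 q.2).sum

lemma splitSum_nil (F : List α → List α → ℂ) : splitSum F [] = F [] [] := by
  simp [splitSum, splits]

lemma splitSum_cons (F : List α → List α → ℂ) (a : α) (w : List α) :
    splitSum F (a :: w) =
      splitSum (fun x y => F x (a :: y)) w + splitSum (fun x y => F (a :: x) y) w := by
  simp [splitSum, splits, Function.comp_def]

lemma sublist_of_mem_splits {w : List α} {q : List α × List α} (hq : q ∈ splits w) :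
    q.1.Sublist w ∧ q.2.Sublist w ∧ q.1.length + q.2.length = w.length := by
  induction w generalizing q with
  | nil => simp [splits] at hq; subst hq; simp
  | cons a w ih =>
    simp only [splits, List.mem_append, List.mem_map] at hq
    rcases hq with ⟨r, hr, rfl⟩ | ⟨r, hr, rfl⟩ <;> obtain ⟨h1, h2, h3⟩ := ih hr
    · exact ⟨h1.cons a, h2.cons_cons a, by simp; omega⟩
    · exact ⟨h1.cons_cons a, h2.cons a, by simp; omega⟩

lemma length_splits (w : List α) : (splits w).length = 2 ^ w.length := by
  induction w with
  | nil => simp [splits]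
  | cons a w ih => simp [splits, ih, pow_succ]; ring

lemma splitSum_congr {F G : List α → List α → ℂ} {w : List α}
    (h : ∀ x y, (x, y) ∈ splits w → F x y = G x y) : splitSum F w = splitSum G w := by
  unfold splitSum
  congr 1
  exact List.map_congr_left fun q hq => h q.1 q.2 hq

lemma splitSum_sub (F G : List α → List α → ℂ) (w : List α) :
    splitSum (fun x y => F x y - G x y) w = splitSum F w - splitSum G w := by
  induction w generalizing F G with
  | nil => simp [splitSum_nil]
  | cons a w ih => simp only [splitSum_cons, ih]; ring

lemma norm_splitSum_le {F : List α → List α → ℂ} {w : List α} {K : ℝ}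
    (h : ∀ x y, (x, y) ∈ splits w → ‖F x y‖ ≤ K) : ‖splitSum F w‖ ≤ 2 ^ w.length * K := by
  have h1 : ∀ l : List ℂ, (∀ z ∈ l, ‖z‖ ≤ K) → ‖l.sum‖ ≤ l.length * K := by
    intro l hl
    induction l with
    | nil => simp
    | cons z l ih =>
      have h2 := hl z (by simp)
      have h3 := ih fun y hy => hl y (by simp [hy])
      simp only [List.sum_cons, List.length_cons]
      push_cast
      linarith [norm_add_le z l.sum]
  have h2 := h1 ((splits w).map fun q => F q.1 q.2) (by
    simp only [List.mem_map]
    rintro z ⟨q, hq, rfl⟩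
    exact h q.1 q.2 hq)
  simpa [splitSum, length_splits] using h2

/-- Splittings of a word are pairs of splittings of its two subwords selected by a predicate. -/
lemma splitSum_filter (p : α → Bool) (F G : List α → List α → ℂ) (w : List α) :
    splitSum (fun x y => F (x.filter fun i => !p i) (y.filter fun i => !p i) *
        G (x.filter p) (y.filter p)) w =
      splitSum F (w.filter fun i => !p i) * splitSum G (w.filter p) := by
  induction w generalizing F G with
  | nil => simp [splitSum_nil]
  | cons a w ih =>
    rw [splitSum_cons]
    cases hp : p a
    · simp only [List.filter_cons, hp, Bool.not_false, if_true, Bool.false_eq_true, if_false]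
      rw [ih (fun x y => F x (a :: y)) G, ih (fun x y => F (a :: x) y) G, splitSum_cons]
      ring
    · simp only [List.filter_cons, hp, Bool.not_true, if_true, Bool.false_eq_true, if_false]
      rw [ih F (fun x y => G x (a :: y)), ih F (fun x y => G (a :: x) y), splitSum_cons]
      ring

/-- The indicator of the empty word is the unit of the shuffle product; equivalently, it is the
connected part of `z` relative to itself. -/
lemma splitSum_isEmpty_right (g : List α → ℂ) (w : List α) :
    splitSum (fun x y => g x * if y = [] then 1 else 0) w = g w := by
  induction w generalizing g with
  | nil => simp [splitSum_nil]
  | cons a w ih =>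
    rw [splitSum_cons, ih (fun x => g (a :: x))]
    simp [splitSum]

/-- The part of a splitting sum in which the first subword is not empty. -/
lemma splitSum_isEmpty_left (F : List α → List α → ℂ) (w : List α) :
    splitSum F w = F [] w + splitSum (fun x y => if x = [] then 0 else F x y) w := by
  induction w generalizing F with
  | nil => simp [splitSum_nil]
  | cons a w ih =>
    rw [splitSum_cons, splitSum_cons, ih (fun x y => F x (a :: y))]
    simp
    ring

/-- The connected part of `m` relative to `z`: the solution of `∑ z x * C y = m w`, the sum being
over all splittings of the word `w`. -/
noncomputable def connected (z m : List α → ℂ) (w : List α) : ℂ :=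
  m w - ((splits w).attach.map fun q =>
    if h : q.1.1 = [] then 0 else z q.1.1 * connected z m q.1.2).sum
termination_by w.length
decreasing_by
  have := (sublist_of_mem_splits q.2).2.2
  have := List.length_pos_iff.2 h
  omega

lemma connected_eq (z m : List α → ℂ) (w : List α) :
    connected z m w =
      m w - splitSum (fun x y => if x = [] then 0 else z x * connected z m y) w := by
  rw [connected]
  congr 1
  simp only [dite_eq_ite]
  conv_rhs => rw [splitSum, ← List.attach_map_subtype_val (splits w), List.map_map]
  rfl

lemma splitSum_connected {z : List α → ℂ} (hz : z [] = 1) (m : List α → ℂ) (w : List α) :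
    splitSum (fun x y => z x * connected z m y) w = m w := by
  rw [splitSum_isEmpty_left, hz, one_mul, connected_eq]
  ring

/-- The scale `M` is kept apart from `B` because the connected part is linear in `m`: later `M`
bounds the norm of the observable, which must enter the estimate linearly. -/
lemma exists_norm_connected_le (n : ℕ) (B : ℝ) (hB : 0 ≤ B) : ∃ K : ℝ, 0 ≤ K ∧
    ∀ {α : Type} (z m : List α → ℂ) (M : ℝ) (w : List α), 0 ≤ M → w.length ≤ n →
      (∀ x, x.Sublist w → ‖z x‖ ≤ B) → (∀ x, x.Sublist w → ‖m x‖ ≤ M * B) →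
      ‖connected z m w‖ ≤ M * K := by
  induction n with
  | zero =>
    refine ⟨B, hB, fun z m M w hM hw _ hm => ?_⟩
    have : w = [] := by simpa using hw
    subst this
    rw [connected_eq]
    simpa [splitSum_nil] using hm [] (by simp)
  | succ n ih =>
    obtain ⟨K, hK, ih⟩ := ih
    refine ⟨B + 2 ^ (n + 1) * (B * K), by positivity, fun z m M w hM hw hz hm => ?_⟩
    rw [connected_eq]
    have h1 : ‖splitSum (fun x y => if x = [] then 0 else z x * connected z m y) w‖ ≤
        2 ^ w.length * (B * (M * K)) := by
      refine norm_splitSum_le fun x y hxy => ?_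
      obtain ⟨h1, h2, h3⟩ := sublist_of_mem_splits hxy
      split_ifs with hx
      · simp; positivity
      · rw [norm_mul]
        have h4 := List.length_pos_iff.2 hx
        have h5 := ih z m M y hM (by simp at h3; omega) (fun u hu => hz u (hu.trans h2))
          (fun u hu => hm u (hu.trans h2))
        exact mul_le_mul (hz x h1) h5 (norm_nonneg _) hB
    have h2 : (2 : ℝ) ^ w.length ≤ 2 ^ (n + 1) := pow_le_pow_right₀ (by norm_num) hw
    calc _ ≤ ‖m w‖ + _ := norm_sub_le _ _
      _ ≤ M * B + 2 ^ (n + 1) * (B * (M * K)) := by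
          refine add_le_add (hm w (List.Sublist.refl w)) (h1.trans ?_)
          gcongr
      _ = _ := by ring

/-- If `z` and `m` factorise approximately over the two subwords selected by a predicate `p`, then
the connected part approximately vanishes on words that have a letter with property `p`. -/
lemma exists_norm_connected_sub_le (n : ℕ) (B : ℝ) (hB : 0 ≤ B) : ∃ K : ℝ, 0 ≤ K ∧
    ∀ {α : Type} (p : α → Bool) (z m : List α → ℂ) (M δ : ℝ) (w : List α),
      0 ≤ M → 0 ≤ δ → w.length ≤ n → z [] = 1 →
      (∀ x, x.Sublist w → ‖z x‖ ≤ B) → (∀ x, x.Sublist w → ‖m x‖ ≤ M * B) →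
      (∀ x, x.Sublist w → ‖z x - z (x.filter fun i => !p i) * z (x.filter p)‖ ≤ δ) →
      (∀ x, x.Sublist w → ‖m x - m (x.filter fun i => !p i) * z (x.filter p)‖ ≤ M * δ) →
      ‖connected z m w - connected z m (w.filter fun i => !p i) *
        (if w.filter p = [] then 1 else 0)‖ ≤ M * (K * δ) := by
  induction n with
  | zero =>
    refine ⟨0, le_rfl, fun p z m M δ w hM hδ hw hz _ _ _ _ => ?_⟩
    have : w = [] := by simpa using hw
    subst this
    simp
  | succ n ih =>
    obtain ⟨K, hK, ih⟩ := ih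
    obtain ⟨K₁, hK₁, hbd⟩ := exists_norm_connected_le n B hB
    refine ⟨1 + 2 ^ (n + 1) * (B * K + K₁), by positivity,
      fun {α} p z m M δ w hM hδ hw hz1 hz hm hzf hmf => ?_⟩
    set C := connected z m with hC
    -- The connected part that exact factorisation would give. It solves the defining equation with
    -- `z` and `m` replaced by their factorised forms, so `C - C'` obeys a recursion driven by the
    -- errors `δ`.
    set C' : List α → ℂ := fun y => C (y.filter fun i => !p i) *
      (if y.filter p = [] then 1 else 0) with hC'
    set f : List α → List α → ℂ := fun x y => z (x.filter fun i => !p i) * z (x.filter p) * C' y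
      with hf
    have hsum : splitSum f w = m (w.filter fun i => !p i) * z (w.filter p) := by
      have h1 := splitSum_filter p (fun x y => z x * C y)
        (fun x y => z x * if y = [] then 1 else 0) w
      rw [splitSum_connected hz1, splitSum_isEmpty_right] at h1
      rw [← h1]
      exact splitSum_congr fun x y _ => by simp only [hf, hC']; ring
    have hf0 : f [] w = C' w := by simp [hf, hz1]
    have hC'w : C' w = m (w.filter fun i => !p i) * z (w.filter p) -
        splitSum (fun x y => if x = [] then 0 else f x y) w := by
      rw [← hsum, splitSum_isEmpty_left f, hf0]; ring
    have hCw : C w = m w - splitSum (fun x y => if x = [] then 0 else z x * C y) w :=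
      connected_eq z m w
    have key : ‖splitSum (fun x y => (if x = [] then 0 else z x * C y) -
        (if x = [] then 0 else f x y)) w‖ ≤ 2 ^ w.length * (B * (M * (K * δ)) + δ * (M * K₁)) := by
      refine norm_splitSum_le fun x y hxy => ?_
      obtain ⟨h1, h2, h3⟩ := sublist_of_mem_splits hxy
      split_ifs with hx
      · simp; positivity
      · have h4 := List.length_pos_iff.2 hx
        have hlen : y.length ≤ n := by simp at h3; omega
        have h5 := ih p z m M δ y hM hδ hlen hz1 (fun u hu => hz u (hu.trans h2))
          (fun u hu => hm u (hu.trans h2)) (fun u hu => hzf u (hu.trans h2))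
          (fun u hu => hmf u (hu.trans h2))
        have h6 : ‖C' y‖ ≤ M * K₁ := by
          have hs : (y.filter fun i => !p i).Sublist y := List.filter_sublist
          have h7 := hbd z m M (y.filter fun i => !p i) hM (hs.length_le.trans hlen)
            (fun u hu => hz u ((hu.trans hs).trans h2)) (fun u hu => hm u ((hu.trans hs).trans h2))
          simp only [hC']
          split_ifs
          · simpa using h7
          · simp; positivity
        -- As `x` is not empty, `y` is shorter than `w`: the first term is controlled by induction,
        -- the second by the factorisation error of `z`.
        have h8 : z x * C y - f x y = z x * (C y - C' y) +
            (z x - z (x.filter fun i => !p i) * z (x.filter p)) * C' y := by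
          simp only [hf]; ring
        rw [h8]
        refine (norm_add_le _ _).trans (add_le_add ?_ ?_)
        · rw [norm_mul]; exact mul_le_mul (hz x h1) h5 (norm_nonneg _) hB
        · rw [norm_mul]; exact mul_le_mul (hzf x h1) h6 (norm_nonneg _) hδ
    rw [splitSum_sub] at key
    have h2 : (2 : ℝ) ^ w.length ≤ 2 ^ (n + 1) := pow_le_pow_right₀ (by norm_num) hw
    change ‖C w - C' w‖ ≤ _
    have h9 : C w - C' w = (m w - m (w.filter fun i => !p i) * z (w.filter p)) -
        (splitSum (fun x y => if x = [] then 0 else z x * C y) w -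
          splitSum (fun x y => if x = [] then 0 else f x y) w) := by
      rw [hCw, hC'w]; ring
    rw [h9]
    calc _ ≤ _ := norm_sub_le _ _
      _ ≤ M * δ + 2 ^ (n + 1) * (B * (M * (K * δ)) + δ * (M * K₁)) := by
          refine add_le_add (hmf w (List.Sublist.refl w)) (key.trans ?_)
          gcongr
      _ = _ := by ring

/-! ### Sums over words -/

/-- The sum of `f w` over all words `w` of length `n` with letters in `S`. -/
def wordSum {R : Type*} [AddCommMonoid R] (S : Finset α) : ℕ → (List α → R) → R
  | 0, f => f []
  | n + 1, f => ∑ i ∈ S, wordSum S n fun w => f (i :: w)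

lemma wordSum_add {R : Type*} [AddCommMonoid R] (S : Finset α) (n : ℕ) (f g : List α → R) :
    wordSum S n (fun w => f w + g w) = wordSum S n f + wordSum S n g := by
  induction n generalizing f g with
  | zero => rfl
  | succ n ih => simp only [wordSum, ih, Finset.sum_add_distrib]

lemma wordSum_sub (S : Finset α) (n : ℕ) (f g : List α → ℂ) :
    wordSum S n (fun w => f w - g w) = wordSum S n f - wordSum S n g := by
  induction n generalizing f g with
  | zero => rfl
  | succ n ih => simp only [wordSum, ih, Finset.sum_sub_distrib]

lemma wordSum_const_mul {R : Type*} [Semiring R] (S : Finset α) (n : ℕ) (c : R)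
    (f : List α → R) : wordSum S n (fun w => c * f w) = c * wordSum S n f := by
  induction n generalizing f with
  | zero => rfl
  | succ n ih => simp only [wordSum, ih, Finset.mul_sum]

lemma norm_wordSum_le (S : Finset α) (n : ℕ) {f : List α → ℂ} {g : List α → ℝ}
    (h : ∀ w, w.length = n → (∀ i ∈ w, i ∈ S) → ‖f w‖ ≤ g w) :
    ‖wordSum S n f‖ ≤ wordSum S n g := by
  induction n generalizing f g with
  | zero => exact h [] rfl (by simp)
  | succ n ih =>
    refine (norm_sum_le _ _).trans (Finset.sum_le_sum fun i hi => ih fun w hw hS => ?_)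
    refine h (i :: w) (by simp [hw]) fun j hj => ?_
    rcases List.mem_cons.1 hj with rfl | hj
    · exact hi
    · exact hS j hj

lemma wordSum_mul_const {R : Type*} [Semiring R] (S : Finset α) (n : ℕ) (f : List α → R)
    (c : R) : wordSum S n (fun w => f w * c) = wordSum S n f * c := by
  induction n generalizing f with
  | zero => rfl
  | succ n ih => simp only [wordSum, ih, Finset.sum_mul]

lemma map_wordSum {R R' : Type*} [AddCommMonoid R] [AddCommMonoid R'] (φ : R →+ R') (S : Finset α)
    (n : ℕ) (f : List α → R) : φ (wordSum S n f) = wordSum S n (fun w => φ (f w)) := by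
  induction n generalizing f with
  | zero => rfl
  | succ n ih => simp only [wordSum, ← ih, map_sum]

lemma wordSum_prod {R : Type*} [Semiring R] (S : Finset α) (n : ℕ) (g : α → R) :
    wordSum S n (fun w => (w.map g).prod) = (∑ i ∈ S, g i) ^ n := by
  induction n with
  | zero => simp [wordSum]
  | succ n ih =>
    simp only [wordSum, List.map_cons, List.prod_cons, wordSum_const_mul, ih]
    rw [← Finset.sum_mul, pow_succ']

open Classical in
lemma wordSum_subset {S T : Finset α} (hST : S ⊆ T) (n : ℕ) (f : List α → ℂ) :
    wordSum S n f = wordSum T n (fun w => if ∀ i ∈ w, i ∈ S then f w else 0) := by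
  have h0 : ∀ n, wordSum T n (fun _ : List α => (0 : ℂ)) = 0 := fun n => by
    simpa using wordSum_const_mul T n (0 : ℂ) (fun _ => 0)
  induction n generalizing f with
  | zero => simp [wordSum]
  | succ n ih =>
    simp only [wordSum, ih]
    rw [← Finset.sum_subset hST]
    · refine Finset.sum_congr rfl fun i hi => ?_
      simp [hi]
    · intro i _ hi
      simp [hi, h0]

/-- The shuffle product corresponds to the Leibniz rule. -/
lemma wordSum_splitSum (S : Finset α) (n : ℕ) (f g : List α → ℂ) :
    wordSum S n (splitSum fun x y => f x * g y) =
      ∑ i ∈ Finset.range (n + 1), (n.choose i : ℂ) * wordSum S i f * wordSum S (n - i) g := by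
  induction n generalizing f g with
  | zero => simp [wordSum, splitSum_nil]
  | succ n ih =>
    -- The first letter goes to one of the two subwords; the two resulting binomial sums are
    -- recombined by Pascal's rule.
    simp only [wordSum, splitSum_cons, wordSum_add, Finset.sum_add_distrib]
    have h1 : ∀ a, wordSum S n (splitSum fun x y => f x * g (a :: y)) = _ :=
      fun a => ih f (fun y => g (a :: y))
    have h2 : ∀ a, wordSum S n (splitSum fun x y => f (a :: x) * g y) = _ :=
      fun a => ih (fun x => f (a :: x)) g
    simp only [h1, h2]
    rw [Finset.sum_comm, Finset.sum_comm (s := S)]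
    simp only [← Finset.mul_sum, ← Finset.sum_mul, mul_assoc]
    change ∑ i ∈ Finset.range (n + 1), (n.choose i : ℂ) * (wordSum S i f * wordSum S (n - i + 1) g) +
      ∑ i ∈ Finset.range (n + 1), (n.choose i : ℂ) * (wordSum S (i + 1) f * wordSum S (n - i) g) = _
    rw [Finset.sum_range_succ' _ (n + 1)]
    simp only [Nat.choose_succ_succ, Nat.cast_add, add_mul, Finset.sum_add_distrib,
      Nat.add_sub_add_right]
    rw [add_comm, add_assoc]
    congr 1
    rw [Finset.sum_range_succ' _ n]
    rw [Finset.sum_range_succ _ n]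
    simp only [Nat.choose_succ_self, Nat.cast_zero, zero_mul, add_zero, Nat.choose_zero_right,
      Nat.sub_zero]
    congr 1
    refine Finset.sum_congr rfl fun i hi => ?_
    have : n - (i + 1) + 1 = n - i := by have := Finset.mem_range.1 hi; omega
    rw [this]

end Words

/-! ### Localised operators -/

-- Separating the coordinates inside and outside `X` turns localisation into the form M ⊗ 1, so
-- closure under the algebraic operations is inherited from Kronecker products.
open scoped Kronecker in
lemma localisedOn_iff (X : Finset (Fin L)) (A : Op L d) :
    LocalisedOn X A ↔ ∃ M : Matrix (X → Fin d) (X → Fin d) ℂ,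
      A = (M ⊗ₖ (1 : Matrix ({i // i ∉ X} → Fin d) ({i // i ∉ X} → Fin d) ℂ)).submatrix
        (Equiv.piEquivPiSubtypeProd (fun i => i ∈ X) fun _ => Fin d)
        (Equiv.piEquivPiSubtypeProd (fun i => i ∈ X) fun _ => Fin d) := by
  have hiff : ∀ σ τ : Config L d,
      ((fun i : {i // i ∉ X} => σ i.1) = fun i => τ i.1) ↔ ∀ i, i ∉ X → σ i = τ i := fun σ τ => by
    simp [funext_iff]
  refine exists_congr fun M => ⟨fun ⟨h1, h2⟩ => ?_, fun h => ?_⟩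
  · ext σ τ
    by_cases h : ∀ i, i ∉ X → σ i = τ i
    · rw [h1 σ τ h]
      simp [Matrix.kroneckerMap_apply, Equiv.piEquivPiSubtypeProd, (hiff σ τ).2 h]
    · have h' := h
      push Not at h
      rw [h2 σ τ h]
      have h3 := mt (hiff σ τ).1 h'
      simp [Matrix.kroneckerMap_apply, Equiv.piEquivPiSubtypeProd, h3]
  · subst h
    refine ⟨fun σ τ h => ?_, fun σ τ h => ?_⟩
    · simp [Matrix.kroneckerMap_apply, Equiv.piEquivPiSubtypeProd, (hiff σ τ).2 h]
    · have h' : ¬ ∀ i, i ∉ X → σ i = τ i := by push Not; exact h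
      have h3 := mt (hiff σ τ).1 h'
      simp [Matrix.kroneckerMap_apply, Equiv.piEquivPiSubtypeProd, h3]

namespace LocalisedOn

variable {X Y : Finset (Fin L)} {A B : Op L d}

lemma exists_eq_smul_one (hA : LocalisedOn ∅ A) : ∃ z : ℂ, A = z • 1 := by
  obtain ⟨M, h1, h2⟩ := hA
  refine ⟨M (fun i => absurd i.2 (Finset.notMem_empty _))
    (fun i => absurd i.2 (Finset.notMem_empty _)), ?_⟩
  ext σ τ
  by_cases hστ : σ = τ
  · subst hστ
    rw [h1 σ σ fun _ _ => rfl, Matrix.smul_apply, Matrix.one_apply_eq, smul_eq_mul, mul_one]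
    congr 1 <;> exact Subsingleton.elim _ _
  · rw [h2 σ τ (by simpa using Function.ne_iff.1 hστ)]
    simp [hστ]

lemma mul (hA : LocalisedOn X A) (hB : LocalisedOn X B) : LocalisedOn X (A * B) := by
  rw [localisedOn_iff] at *
  obtain ⟨M, rfl⟩ := hA
  obtain ⟨N, rfl⟩ := hB
  exact ⟨M * N, by rw [Matrix.submatrix_mul_equiv, ← Matrix.mul_kronecker_mul, one_mul]⟩

lemma add (hA : LocalisedOn X A) (hB : LocalisedOn X B) : LocalisedOn X (A + B) := by
  rw [localisedOn_iff] at *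
  obtain ⟨M, rfl⟩ := hA
  obtain ⟨N, rfl⟩ := hB
  exact ⟨M + N, by rw [Matrix.add_kronecker]; rfl⟩

lemma smul (z : ℂ) (hA : LocalisedOn X A) : LocalisedOn X (z • A) := by
  rw [localisedOn_iff] at *
  obtain ⟨M, rfl⟩ := hA
  exact ⟨z • M, by rw [Matrix.smul_kronecker]; rfl⟩

lemma one (X : Finset (Fin L)) : LocalisedOn X (1 : Op L d) := by
  rw [localisedOn_iff]
  exact ⟨1, by rw [Matrix.one_kronecker_one, Matrix.submatrix_one_equiv]⟩

lemma zero (X : Finset (Fin L)) : LocalisedOn X (0 : Op L d) := by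
  simpa using (one X).smul 0

lemma sum {ι : Type*} (s : Finset ι) {f : ι → Op L d} (h : ∀ i ∈ s, LocalisedOn X (f i)) :
    LocalisedOn X (∑ i ∈ s, f i) :=
  Finset.sum_induction f (LocalisedOn X) (fun _ _ => add) (zero X) h

lemma pow (hA : LocalisedOn X A) (n : ℕ) : LocalisedOn X (A ^ n) := by
  induction n with
  | zero => simpa using one X
  | succ n ih => rw [pow_succ]; exact ih.mul hA

lemma prod {w : List (Fin L)} {g : Fin L → Op L d} (h : ∀ i ∈ w, LocalisedOn X (g i)) :
    LocalisedOn X (w.map g).prod := by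
  induction w with
  | nil => simpa using one X
  | cons a w ih =>
    rw [List.map_cons, List.prod_cons]
    exact (h a (by simp)).mul (ih fun i hi => h i (by simp [hi]))

open Classical in
lemma mono (hA : LocalisedOn X A) (hXY : X ⊆ Y) : LocalisedOn Y A := by
  obtain ⟨M, h1, h2⟩ := hA
  refine ⟨fun σ τ => if ∀ i : Y, (i : Fin L) ∉ X → σ i = τ i then
    M (fun i => σ ⟨i, hXY i.2⟩) (fun i => τ ⟨i, hXY i.2⟩) else 0, fun σ τ h => ?_, fun σ τ h => ?_⟩
  · beta_reduce
    split_ifs with hc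
    · refine h1 σ τ fun i hi => ?_
      by_cases hY : i ∈ Y
      · exact hc ⟨i, hY⟩ hi
      · exact h i hY
    · push Not at hc
      obtain ⟨i, hi, hne⟩ := hc
      exact h2 σ τ ⟨i, hi, hne⟩
  · obtain ⟨i, hi, hne⟩ := h
    exact h2 σ τ ⟨i, fun hX => hi (hXY hX), hne⟩

open Classical in
open scoped Kronecker in
lemma commute (hA : LocalisedOn X A) (hB : LocalisedOn Y B) (hXY : Disjoint X Y) :
    Commute A B := by
  rw [localisedOn_iff] at hA
  obtain ⟨M, rfl⟩ := hA
  obtain ⟨N, h1, h2⟩ := hB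
  have hX : ∀ i : Y, (i : Fin L) ∉ X := fun i hi => Finset.disjoint_left.1 hXY hi i.2
  -- In the tensor splitting adapted to `X`, an operator supported away from `X` is 1 ⊗ N, which
  -- commutes with M ⊗ 1.
  have hB : B = ((1 : Matrix (X → Fin d) (X → Fin d) ℂ) ⊗ₖ
      (Matrix.of fun σ τ : {i // i ∉ X} → Fin d =>
        if ∀ i : {i // i ∉ X}, (i : Fin L) ∉ Y → σ i = τ i then
          N (fun i => σ ⟨i, hX i⟩) (fun i => τ ⟨i, hX i⟩) else 0)).submatrix
        (Equiv.piEquivPiSubtypeProd (fun i => i ∈ X) fun _ => Fin d)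
        (Equiv.piEquivPiSubtypeProd (fun i => i ∈ X) fun _ => Fin d) := by
    ext σ τ
    by_cases h : ∀ i, i ∉ Y → σ i = τ i
    · rw [h1 σ τ h]
      have h3 : ((fun i : X => σ i) = fun i : X => τ i) :=
        funext fun i => h i (Finset.disjoint_left.1 hXY i.2)
      have h4 : ∀ i : {i // i ∉ X}, (i : Fin L) ∉ Y → σ i = τ i := fun i hi => h i hi
      simp only [Matrix.submatrix_apply, Equiv.piEquivPiSubtypeProd, Equiv.coe_fn_mk,
        Matrix.kroneckerMap_apply, Matrix.of_apply]
      rw [h3, Matrix.one_apply_eq, one_mul]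
      exact (if_pos h4).symm
    · have h' := h
      push Not at h
      rw [h2 σ τ h]
      obtain ⟨i, hi, hne⟩ := h
      simp only [Matrix.submatrix_apply, Equiv.piEquivPiSubtypeProd, Equiv.coe_fn_mk,
        Matrix.kroneckerMap_apply, Matrix.of_apply]
      by_cases hiX : i ∈ X
      · rw [Matrix.one_apply_ne (fun hc => hne (congrFun hc ⟨i, hiX⟩)), zero_mul]
      · rw [if_neg (fun hc => hne (hc ⟨i, hiX⟩ hi)), mul_zero]
  rw [hB]
  unfold Commute SemiconjBy
  rw [Matrix.submatrix_mul_equiv, Matrix.submatrix_mul_equiv, ← Matrix.mul_kronecker_mul,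
    ← Matrix.mul_kronecker_mul, one_mul, mul_one, one_mul, mul_one]

end LocalisedOn

/-! ### Geometry of the chain -/

lemma siteDist_comm (b : Boundary) (i j : Fin L) : siteDist b i j = siteDist b j i := by
  cases b <;> simp only [siteDist] <;> omega

lemma siteDist_self (b : Boundary) (i : Fin L) : siteDist b i i = 0 := by
  cases b <;> simp [siteDist]

lemma siteDist_triangle (b : Boundary) (i j k : Fin L) :
    siteDist b i k ≤ siteDist b i j + siteDist b j k := by
  have := i.2; have := j.2; have := k.2
  cases b <;> simp only [siteDist] <;> omega

lemma siteDist_lt (b : Boundary) (i j : Fin L) : siteDist b i j < L := by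
  have := i.2; have := j.2
  cases b <;> simp only [siteDist] <;> omega

lemma mem_thicken {b : Boundary} {Z : Finset (Fin L)} {r : ℕ} {i : Fin L} :
    i ∈ thicken b Z r ↔ ∃ j ∈ Z, siteDist b i j ≤ r := by
  simp [thicken]

lemma mem_thicken_singleton {b : Boundary} {j : Fin L} {r : ℕ} {i : Fin L} :
    i ∈ thicken b {j} r ↔ siteDist b i j ≤ r := by
  simp [thicken]

lemma subset_thicken (b : Boundary) (Z : Finset (Fin L)) (r : ℕ) : Z ⊆ thicken b Z r :=
  fun i hi => mem_thicken.2 ⟨i, hi, by simp [siteDist_self]⟩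

lemma thicken_mono {b : Boundary} {Z : Finset (Fin L)} {r s : ℕ} (h : r ≤ s) :
    thicken b Z r ⊆ thicken b Z s := fun i hi => by
  obtain ⟨j, hj, hd⟩ := mem_thicken.1 hi
  exact mem_thicken.2 ⟨j, hj, hd.trans h⟩

lemma thicken_subset_thicken {b : Boundary} {Z Z' : Finset (Fin L)} (h : Z ⊆ Z') (r : ℕ) :
    thicken b Z r ⊆ thicken b Z' r := fun i hi => by
  obtain ⟨j, hj, hd⟩ := mem_thicken.1 hi
  exact mem_thicken.2 ⟨j, h hj, hd⟩

/-- For either boundary condition, i - j can only be one of ±r and ±(L - r). -/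
lemma card_sphere_le (b : Boundary) (j : Fin L) (r : ℕ) :
    (Finset.univ.filter fun i => siteDist b i j = r).card ≤ 4 := by
  refine (Finset.card_le_card_of_injOn (t := {(j : ℤ) + r, (j : ℤ) - r, (j : ℤ) + (L - r),
    (j : ℤ) - (L - r)}) (fun i : Fin L => (i : ℤ)) ?_ ?_).trans Finset.card_le_four
  · intro i hi
    have h : siteDist b i j = r := by simpa using hi
    have := i.2; have := j.2
    simp only [Finset.coe_insert, Finset.coe_singleton, Set.mem_insert_iff, Set.mem_singleton_iff]
    cases b <;> simp only [siteDist] at h <;> omega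
  · intro i _ k _ h
    simpa [Fin.ext_iff] using h

lemma card_thicken_singleton_le (b : Boundary) (j : Fin L) (r : ℕ) :
    (thicken b {j} r).card ≤ 4 * (r + 1) := by
  have h := Finset.card_le_mul_card_image_of_maps_to (s := thicken b {j} r)
    (t := Finset.range (r + 1)) (f := fun i => siteDist b i j)
    (fun i hi => Finset.mem_range.2 (Nat.lt_succ_of_le (mem_thicken_singleton.1 hi))) 4
    (fun s _ => (Finset.card_le_card
      (Finset.filter_subset_filter _ (Finset.subset_univ _))).trans (card_sphere_le b j s))
  simpa using h

lemma sum_exp_siteDist_le (b : Boundary) (j : Fin L) {κ : ℝ} (hκ : 0 < κ) :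
    ∑ i, Real.exp (-κ * siteDist b i j) ≤ 4 * (1 - Real.exp (-κ))⁻¹ := by
  have h1 : ∀ r : ℕ, Real.exp (-κ * r) = Real.exp (-κ) ^ r := fun r => by
    rw [← Real.exp_nat_mul]; ring_nf
  have hlt : Real.exp (-κ) < 1 := by rw [Real.exp_lt_one_iff]; linarith
  calc ∑ i, Real.exp (-κ * siteDist b i j)
      = ∑ r ∈ Finset.range L, ∑ i ∈ Finset.univ.filter (fun i => siteDist b i j = r),
          Real.exp (-κ * siteDist b i j) := by
        rw [Finset.sum_fiberwise_of_maps_to]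
        exact fun i _ => Finset.mem_range.2 (siteDist_lt b i j)
    _ ≤ ∑ r ∈ Finset.range L, 4 * Real.exp (-κ) ^ r := by
        refine Finset.sum_le_sum fun r _ => ?_
        rw [Finset.sum_congr rfl (g := fun _ => Real.exp (-κ) ^ r)
          (fun i hi => by rw [(Finset.mem_filter.1 hi).2, h1]), Finset.sum_const, nsmul_eq_mul]
        gcongr
        exact_mod_cast card_sphere_le b j r
    _ = 4 * ∑ r ∈ Finset.range L, Real.exp (-κ) ^ r := by rw [Finset.mul_sum]
    _ ≤ 4 * (1 - Real.exp (-κ))⁻¹ := by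
        gcongr
        rw [← tsum_geometric_of_lt_one (Real.exp_nonneg _) hlt]
        exact (summable_geometric_of_lt_one (Real.exp_nonneg _) hlt).sum_le_tsum _
          fun _ _ => by positivity

/-- The distance of a site from a set of sites. -/
noncomputable def distTo (b : Boundary) (Z : Finset (Fin L)) (i : Fin L) : ℕ :=
  sInf {r | i ∈ thicken b Z r}

lemma mem_thicken_iff_distTo_le {b : Boundary} {Z : Finset (Fin L)} (hZ : Z.Nonempty) {r : ℕ}
    {i : Fin L} : i ∈ thicken b Z r ↔ distTo b Z i ≤ r := by
  refine ⟨fun h => Nat.sInf_le h, fun h => thicken_mono h ?_⟩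
  obtain ⟨j, hj⟩ := hZ
  exact Nat.sInf_mem (s := {r | i ∈ thicken b Z r}) ⟨siteDist b i j, mem_thicken.2 ⟨j, hj, le_rfl⟩⟩

lemma sum_exp_distTo_le (b : Boundary) {Z : Finset (Fin L)} (hZ : Z.Nonempty) {κ : ℝ}
    (hκ : 0 < κ) : ∑ i, Real.exp (-κ * distTo b Z i) ≤ Z.card * (4 * (1 - Real.exp (-κ))⁻¹) := by
  calc ∑ i, Real.exp (-κ * distTo b Z i)
      ≤ ∑ i, ∑ j ∈ Z, Real.exp (-κ * siteDist b i j) := by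
        refine Finset.sum_le_sum fun i _ => ?_
        obtain ⟨j, hj, hd⟩ := mem_thicken.1 ((mem_thicken_iff_distTo_le hZ).2 (le_refl (distTo b Z i)))
        have h1 : Real.exp (-κ * distTo b Z i) ≤ Real.exp (-κ * siteDist b i j) := by
          have : (siteDist b i j : ℝ) ≤ distTo b Z i := by exact_mod_cast hd
          rw [Real.exp_le_exp]; nlinarith
        exact h1.trans (Finset.single_le_sum (f := fun j => Real.exp (-κ * siteDist b i j))
          (fun _ _ => Real.exp_nonneg _) hj)
    _ = ∑ j ∈ Z, ∑ i, Real.exp (-κ * siteDist b i j) := Finset.sum_comm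
    _ ≤ ∑ j ∈ Z, 4 * (1 - Real.exp (-κ))⁻¹ :=
        Finset.sum_le_sum fun j _ => sum_exp_siteDist_le b j hκ
    _ = _ := by rw [Finset.sum_const, nsmul_eq_mul]

/-- If some letter of a word of length at most `n` is far from the origin, then some annulus of
width `R` contains no letter. -/
lemma exists_empty_annulus {α : Type*} (dist : α → ℕ) (w : List α) {n R : ℕ}
    (hw : w.length ≤ n) {a : α} (ha : a ∈ w) (hfar : n * R < dist a) :
    ∃ s, s + R < dist a ∧ ∀ i ∈ w, dist i ≤ s ∨ s + R < dist i := by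
  classical
  by_contra hcon
  push Not at hcon
  -- Pigeonhole: if each annulus with distances in (jR, (j+1)R], j < n, contained a letter, then
  -- together with `a`, which lies beyond all of them, there would be n + 1 distinct letters. The `-
  -- 1` fits the annuli being open at their inner end.
  have hsub : Finset.range n ⊆ (w.toFinset.erase a).image (fun i => (dist i - 1) / R) := by
    intro j hj
    have hj := Finset.mem_range.1 hj
    have hle : j * R + R ≤ n * R := by
      have := Nat.mul_le_mul_right R (Nat.succ_le_of_lt hj)
      rwa [Nat.succ_mul] at this
    obtain ⟨i, hi, h1, h2⟩ := hcon (j * R) (by omega)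
    refine Finset.mem_image.2 ⟨i, Finset.mem_erase.2 ⟨?_, by simpa using hi⟩, ?_⟩
    · rintro rfl; omega
    · refine Nat.div_eq_of_lt_le (by omega) ?_
      rw [Nat.succ_mul]; omega
  have h1 := Finset.card_le_card hsub
  have h2 := h1.trans Finset.card_image_le
  rw [Finset.card_range, Finset.card_erase_of_mem (by simpa using ha)] at h2
  have h3 := List.toFinset_card_le w
  have h4 : 0 < w.toFinset.card := Finset.card_pos.2 ⟨a, by simpa using ha⟩
  omega

/-! ### Expectation values of words -/

/-- The expectation value of the ordered product of the `h i` over a word, followed by `O`. -/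
noncomputable def wordExpect (ψ : StateVec L d) (h : Fin L → Op L d) (O : Op L d)
    (w : List (Fin L)) : ℂ := expect ψ ((w.map h).prod * O)

lemma wordSum_wordExpect (ψ : StateVec L d) (h : Fin L → Op L d) (O : Op L d)
    (S : Finset (Fin L)) (n : ℕ) :
    wordSum S n (wordExpect ψ h O) = expect ψ (hamiltonian h S ^ n * O) := by
  rw [hamiltonian, ← wordSum_prod, ← wordSum_mul_const]
  exact (map_wordSum (expectLin ψ).toAddMonoidHom S n fun w => (w.map h).prod * O).symm

/-- Both sides obey the same recursion: summed over words, the shuffle equation defining `connected`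
becomes the Leibniz identity for the ratio. -/
lemma ratioDeriv_eq_wordSum {ψ : StateVec L d} (hψ : star ψ ⬝ᵥ ψ = 1) (h : Fin L → Op L d)
    (O : Op L d) (S : Finset (Fin L)) (n : ℕ) :
    ratioDeriv ψ (hamiltonian h S) O n =
      wordSum S n (connected (wordExpect ψ h 1) (wordExpect ψ h O)) := by
  induction n using Nat.strong_induction_on with
  | _ n ih =>
    have h1 := wordSum_splitSum S n (wordExpect ψ h 1)
      (connected (wordExpect ψ h 1) (wordExpect ψ h O))
    have h2 : (splitSum fun x y => wordExpect ψ h 1 x *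
        connected (wordExpect ψ h 1) (wordExpect ψ h O) y) = wordExpect ψ h O :=
      funext (splitSum_connected (by simp [wordExpect, expect_one hψ]) _)
    rw [h2, wordSum_wordExpect, Finset.sum_range_succ'] at h1
    simp only [wordSum_wordExpect, mul_one, pow_zero, expect_one hψ, Nat.choose_zero_right,
      Nat.cast_one, one_mul, Nat.sub_zero] at h1
    rw [ratioDeriv_succ_eq hψ, h1, add_comm, add_sub_assoc, add_eq_left, sub_eq_zero]
    refine Finset.sum_congr rfl fun i hi => ?_
    rw [ih]
    have := Finset.mem_range.1 hi
    omega

lemma norm_wordProd_mul_le {h : Fin L → Op L d} {B : ℝ} (hB : 0 ≤ B) (hh : ∀ i, ‖h i‖ ≤ B)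
    (O : Op L d) (w : List (Fin L)) : ‖(w.map h).prod * O‖ ≤ B ^ w.length * ‖O‖ := by
  induction w with
  | nil => simp
  | cons a w ih =>
    rw [List.map_cons, List.prod_cons, mul_assoc, List.length_cons, pow_succ', mul_assoc]
    exact (norm_mul_le _ _).trans (mul_le_mul (hh a) ih (norm_nonneg _) hB)

/-- The factors are replaced one at a time, and each of the at most `w.length + 1` replacements
costs a multiple of `ε`. -/
lemma norm_wordProd_mul_sub_le {h g : Fin L → Op L d} {O O' : Op L d} {B ε M : ℝ} (hB : 1 ≤ B)
    (hε : 0 ≤ ε) (hM : 0 ≤ M) (hh : ∀ i, ‖h i‖ ≤ B) (hg : ∀ i, ‖g i‖ ≤ B)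
    (hhg : ∀ i, ‖h i - g i‖ ≤ ε) (hO : ‖O - O'‖ ≤ M * ε) (hO' : ‖O'‖ ≤ 2 * M)
    (w : List (Fin L)) :
    ‖(w.map h).prod * O - (w.map g).prod * O'‖ ≤ 2 * M * (w.length + 1) * B ^ w.length * ε := by
  have hB0 : 0 ≤ B := by linarith
  induction w with
  | nil =>
    simp only [List.map_nil, List.prod_nil, one_mul, List.length_nil, Nat.cast_zero, zero_add,
      mul_one, pow_zero]
    nlinarith [mul_nonneg hM hε]
  | cons a w ih =>
    have h1 : ((a :: w).map h).prod * O - ((a :: w).map g).prod * O' =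
        h a * ((w.map h).prod * O - (w.map g).prod * O') +
          (h a - g a) * ((w.map g).prod * O') := by
      simp only [List.map_cons, List.prod_cons]
      noncomm_ring
    have h2 := norm_wordProd_mul_le hB0 hg O' w
    have hP : 0 ≤ B ^ w.length := by positivity
    rw [h1, List.length_cons]
    calc _ ≤ B * (2 * M * (w.length + 1) * B ^ w.length * ε) + ε * (B ^ w.length * (2 * M)) := by
          refine (norm_add_le _ _).trans (add_le_add ?_ ?_)
          · exact (norm_mul_le _ _).trans (mul_le_mul (hh a) ih (norm_nonneg _) hB0)
          · refine (norm_mul_le _ _).trans (mul_le_mul (hhg a) (h2.trans ?_) (norm_nonneg _) hε)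
            gcongr
      _ ≤ B * (2 * M * (w.length + 1) * B ^ w.length * ε) +
          B * (ε * (B ^ w.length * (2 * M))) := by
          have : 0 ≤ ε * (B ^ w.length * (2 * M)) := by positivity
          nlinarith
      _ = _ := by push_cast; ring

/-- Selected letters move to the right past unselected ones only, so no commutation within either
group is needed. -/
lemma wordProd_filter {g : Fin L → Op L d} (p : Fin L → Bool) {w : List (Fin L)}
    (h : ∀ i ∈ w, ∀ j ∈ w, p i = true → p j = false → Commute (g i) (g j)) :
    (w.map g).prod = ((w.filter fun i => !p i).map g).prod * ((w.filter p).map g).prod := by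
  induction w with
  | nil => simp
  | cons a w ih =>
    have ih := ih fun i hi j hj => h i (by simp [hi]) j (by simp [hj])
    rw [List.map_cons, List.prod_cons, ih]
    cases hp : p a
    · simp [hp, mul_assoc]
    · have hc : Commute (g a) ((w.filter fun i => !p i).map g).prod := by
        refine Commute.list_prod_right _ _ fun x hx => ?_
        obtain ⟨j, hj, rfl⟩ := List.mem_map.1 hx
        obtain ⟨hj, hpj⟩ := List.mem_filter.1 hj
        exact h a (by simp) j (by simp [hj]) hp (by simpa using hpj)
      simp only [List.filter_cons, hp, Bool.not_true, Bool.false_eq_true, if_false, if_true,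
        List.map_cons, List.prod_cons]
      rw [← mul_assoc, hc.eq, mul_assoc]

/-! ### Clustering -/

/-- `O` has norm at most `M` and is approximated, up to `M e^{-t/μ}`, by operators localised on
subsets of the `t`-neighbourhood of `Z` with at most `k + 4 (t + 1)` sites. -/
def ApproxLocal (b : Boundary) (μ : ℝ) (k : ℕ) (M : ℝ) (Z : Finset (Fin L)) (O : Op L d) : Prop :=
  ‖O‖ ≤ M ∧ ∀ t : ℕ, ∃ (X : Finset (Fin L)) (O' : Op L d), X ⊆ thicken b Z t ∧
    X.card ≤ k + 4 * (t + 1) ∧ LocalisedOn X O' ∧ ‖O - O'‖ ≤ M * Real.exp (-(t : ℝ) / μ)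

lemma ApproxLocal.nonneg {b : Boundary} {μ : ℝ} {k : ℕ} {M : ℝ} {Z : Finset (Fin L)} {O : Op L d}
    (h : ApproxLocal b μ k M Z O) : 0 ≤ M := (norm_nonneg _).trans h.1

lemma ApproxLocal.one (b : Boundary) (μ : ℝ) (k : ℕ) (Z : Finset (Fin L)) :
    ApproxLocal b μ k 1 Z (1 : Op L d) :=
  ⟨norm_one_le L d, fun t => ⟨∅, 1, by simp, by simp, LocalisedOn.one _, by
    simp [Real.exp_nonneg]⟩⟩

lemma ApproxLocal.of_localisedOn {b : Boundary} {μ : ℝ} {k : ℕ} {Z : Finset (Fin L)} {O : Op L d}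
    (h : LocalisedOn Z O) (hZ : Z.card ≤ k) : ApproxLocal b μ k ‖O‖ Z O :=
  ⟨le_rfl, fun t => ⟨Z, O, subset_thicken b Z t, by omega, h, by simp; positivity⟩⟩

lemma ApproxLocal.of_density {b : Boundary} {J μ : ℝ} (k : ℕ) {h : Fin L → Op L d}
    (hh : IsQuasilocalDensity b J μ h) (l : Fin L) : ApproxLocal b μ k J {l} (h l) := by
  refine ⟨hh.bounded l, fun t => ?_⟩
  obtain ⟨B, hB, hBn⟩ := hh.quasilocalised l t
  exact ⟨_, B, subset_rfl, (card_thicken_singleton_le b l t).trans (by omega), hB, hBn⟩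

/-- Supports of about `m * t` sites cost e^{α m t}; a separation `q * t` with q/ξ ≥ α m + 1/μ pays
for this and leaves the factor e^{-t/μ}. -/
lemma exp_mul_exp_le {α ξ μ : ℝ} (hξ : 0 < ξ) {q : ℕ} {k m t : ℕ}
    (hq : ξ * (α * m + 1 / μ) ≤ q) :
    Real.exp (α * ((k : ℝ) + m * (t + 1))) * Real.exp (-((q * t : ℕ) : ℝ) / ξ) ≤
      Real.exp (α * ((k : ℝ) + m)) * Real.exp (-(t : ℝ) / μ) := by
  rw [← Real.exp_add, ← Real.exp_add, Real.exp_le_exp]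
  have h1 : α * m + 1 / μ ≤ q / ξ := by rw [le_div_iff₀ hξ]; linarith
  have h2 := mul_le_mul_of_nonneg_right h1 (Nat.cast_nonneg (α := ℝ) t)
  have h3 : -((q * t : ℕ) : ℝ) / ξ = -(q / ξ * t) := by push_cast; ring
  have h4 : -(t : ℝ) / μ = -(1 / μ * t) := by ring
  rw [h3, h4]
  linarith

/-- Expectation values of words factorise over an annulus without letters. -/
lemma exists_norm_wordExpect_sub_le (J μ c a ξ : ℝ) (hμ : 0 < μ) (hξ : 0 < ξ) (d n : ℕ) :
    ∃ q : ℕ, ∀ k : ℕ, ∃ K : ℝ, 0 ≤ K ∧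
      ∀ (b : Boundary) (L : ℕ) (h : Fin L → Op L d) (ψ : StateVec L d),
      IsQuasilocalDensity b J μ h → HasCorrelationLength b c a ξ ψ →
      ∀ (Z : Finset (Fin L)) (O : Op L d) (M : ℝ) (t s : ℕ) (w : List (Fin L))
        (p : Fin L → Bool), ApproxLocal b μ k M Z O → w.length ≤ n →
        (∀ i ∈ w, p i = false → i ∈ thicken b Z s) →
        (∀ i ∈ w, p i = true → i ∉ thicken b Z (s + q * t)) →
        ‖wordExpect ψ h O w - wordExpect ψ h O (w.filter fun i => !p i) *
          wordExpect ψ h 1 (w.filter p)‖ ≤ M * (K * Real.exp (-(t : ℝ) / μ)) := by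
  -- The size `k` of the observable does not enter `q`, hence not the final decay rate. The annulus
  -- has width `(q + 2) * t` because the supports on its two sides each extend by `t` into it.
  obtain ⟨q, hq⟩ := exists_nat_ge (ξ * (|a| * (4 * (2 * n + 1) : ℕ) + 1 / μ))
  refine ⟨q + 2, fun k => ?_⟩
  -- An approximant `g i` has norm at most 2|J|: the norm of `h i` plus the approximation error. The
  -- 1 makes powers of `B` monotone.
  set B : ℝ := 2 * |J| + 1 with hBdef
  have hB : 1 ≤ B := by have := abs_nonneg J; linarith
  have hB0 : 0 ≤ B := by linarith
  set D : ℝ := 2 * (n + 1) * B ^ n * B with hD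
  have hD0 : 0 ≤ D := by positivity
  set F : ℝ := |c| * Real.exp (|a| * ((k : ℝ) + (4 * (2 * n + 1) : ℕ))) with hF
  refine ⟨D * (1 + B ^ n + 2 * B ^ n) + 2 * F * B ^ n * B ^ n, by positivity, ?_⟩
  intro b L h ψ hh hψ Z O M t s w p hO hw hp0 hp1
  have hM := hO.nonneg
  have hn := hψ.normalised
  obtain ⟨hOM, hO⟩ := hO
  obtain ⟨X, O', hXt, hXc, hXO, hOO⟩ := hO t
  choose g hgl hgn using fun i => hh.quasilocalised i t
  set E : ℝ := Real.exp (-(t : ℝ) / μ) with hE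
  have hE0 : 0 ≤ E := Real.exp_nonneg _
  have hE1 : E ≤ 1 := by
    rw [hE, Real.exp_le_one_iff, neg_div]
    have : 0 ≤ (t : ℝ) / μ := by positivity
    linarith
  have hJ : ∀ i, ‖h i‖ ≤ |J| := fun i => (hh.bounded i).trans (le_abs_self J)
  have hJE : J * E ≤ |J| * E := by gcongr; exact le_abs_self J
  have hhg : ∀ i, ‖h i - g i‖ ≤ B * E := fun i => by
    refine (hgn i).trans (hJE.trans ?_)
    gcongr
    have := abs_nonneg J; linarith
  have hhB : ∀ i, ‖h i‖ ≤ B := fun i => (hJ i).trans (by have := abs_nonneg J; linarith)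
  have hgB : ∀ i, ‖g i‖ ≤ B := fun i => by
    have h1 := norm_sub_norm_le (g i) (h i)
    rw [norm_sub_rev] at h1
    have h2 := hgn i
    have h3 := hJ i
    have h4 : |J| * E ≤ |J| * 1 := by gcongr
    linarith
  have hO'M : ‖O'‖ ≤ 2 * M := by
    have h1 := norm_sub_norm_le O' O
    rw [norm_sub_rev] at h1
    have h4 : M * E ≤ M * 1 := by gcongr
    linarith
  have hOO' : ‖O - O'‖ ≤ M * (B * E) := by
    refine hOO.trans ?_
    gcongr
    nlinarith
  have hpow : ∀ u : List (Fin L), u.length ≤ n → B ^ u.length ≤ B ^ n :=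
    fun u hu => pow_le_pow_right₀ hB hu
  have hdiff : ∀ (A A' : Op L d) (m : ℝ), 0 ≤ m → ‖A - A'‖ ≤ m * (B * E) → ‖A'‖ ≤ 2 * m →
      ∀ u : List (Fin L), u.length ≤ n →
        ‖wordExpect ψ h A u - wordExpect ψ g A' u‖ ≤ m * D * E := by
    intro A A' m hm h1 h2 u hu
    rw [wordExpect, wordExpect, ← expect_sub]
    refine (norm_expect_le hn _).trans ((norm_wordProd_mul_sub_le hB (by positivity) hm hhB hgB
      hhg h1 h2 u).trans ?_)
    have h3 := hpow u hu
    have h4 : (u.length : ℝ) ≤ n := by exact_mod_cast hu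
    calc 2 * m * (u.length + 1) * B ^ u.length * (B * E)
        ≤ 2 * m * (n + 1) * B ^ n * (B * E) := by gcongr
      _ = m * D * E := by rw [hD]; ring
  have hbd : ∀ (g : Fin L → Op L d) (A : Op L d) (m : ℝ), (∀ i, ‖g i‖ ≤ B) → 0 ≤ m → ‖A‖ ≤ m →
      ∀ u : List (Fin L), u.length ≤ n → ‖(u.map g).prod * A‖ ≤ B ^ n * m := by
    intro g A m hg hm hA u hu
    refine (norm_wordProd_mul_le hB0 hg A u).trans ?_
    have := hpow u hu
    gcongr
  have h1n : ‖(1 : Op L d)‖ ≤ 1 := norm_one_le L d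
  set wP := w.filter fun i => !p i with hwP
  set wQ := w.filter p with hwQ
  have hwPn : wP.length ≤ n := (List.length_filter_le _ _).trans hw
  have hwQn : wQ.length ≤ n := (List.length_filter_le _ _).trans hw
  have hmP : ∀ i ∈ wP, i ∈ w ∧ p i = false := fun i hi => by
    simpa [hwP] using List.mem_filter.1 hi
  have hmQ : ∀ i ∈ wQ, i ∈ w ∧ p i = true := fun i hi => List.mem_filter.1 hi
  -- the supports of the two clusters
  set XP : Finset (Fin L) := X ∪ wP.toFinset.biUnion fun i => thicken b {i} t with hXP
  set YQ : Finset (Fin L) := wQ.toFinset.biUnion fun i => thicken b {i} t with hYQ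
  have hcardw : ∀ u : List (Fin L), u.length ≤ n →
      (u.toFinset.biUnion fun i => thicken b {i} t).card ≤ n * (4 * (t + 1)) := fun u hu => by
    refine (Finset.card_biUnion_le_card_mul _ _ (4 * (t + 1))
      fun i _ => card_thicken_singleton_le b i t).trans ?_
    gcongr
    exact (List.toFinset_card_le u).trans hu
  have hcard : XP.card + YQ.card ≤ k + 4 * (2 * n + 1) * (t + 1) := by
    have h1 : XP.card ≤ _ := Finset.card_union_le X (wP.toFinset.biUnion fun i => thicken b {i} t)
    have h2 := hcardw wP hwPn
    have h3 : YQ.card ≤ _ := hcardw wQ hwQn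
    calc XP.card + YQ.card ≤ (k + 4 * (t + 1) + n * (4 * (t + 1))) + n * (4 * (t + 1)) := by omega
      _ = _ := by ring
  have hfar : ∀ i ∈ XP, ∀ j ∈ YQ, q * t < siteDist b i j := by
    intro i hi j hj
    obtain ⟨y, hy, hjy⟩ := Finset.mem_biUnion.1 hj
    rw [mem_thicken_singleton] at hjy
    obtain ⟨hyw, hyp⟩ := hmQ y (by simpa using hy)
    have hyZ := hp1 y hyw hyp
    have hyZ' : ∀ z ∈ Z, s + (q + 2) * t < siteDist b y z := fun z hz => by
      by_contra hc
      exact hyZ (mem_thicken.2 ⟨z, hz, not_lt.1 hc⟩)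
    have hmul : (q + 2) * t = q * t + 2 * t := by ring
    rw [hmul] at hyZ'
    rcases Finset.mem_union.1 hi with hi | hi
    · obtain ⟨z, hz, hiz⟩ := mem_thicken.1 (hXt hi)
      have h1 := hyZ' z hz
      have h2 := siteDist_triangle b y j z
      have h3 := siteDist_triangle b j i z
      rw [siteDist_comm b y j] at h2
      rw [siteDist_comm b j i] at h3
      omega
    · obtain ⟨x, hx, hix⟩ := Finset.mem_biUnion.1 hi
      rw [mem_thicken_singleton] at hix
      obtain ⟨hxw, hxp⟩ := hmP x (by simpa using hx)
      obtain ⟨z, hz, hxz⟩ := mem_thicken.1 (hp0 x hxw hxp)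
      have h1 := hyZ' z hz
      have h2 := siteDist_triangle b y j z
      have h3 := siteDist_triangle b j i z
      have h4 := siteDist_triangle b i x z
      rw [siteDist_comm b y j] at h2
      rw [siteDist_comm b j i] at h3
      omega
  have hdisj : Disjoint XP YQ := by
    rw [Finset.disjoint_left]
    intro i hi hj
    have := hfar i hi i hj
    rw [siteDist_self] at this
    omega
  have hgP : ∀ i ∈ wP, LocalisedOn XP (g i) := fun i hi => (hgl i).mono
    ((Finset.subset_biUnion_of_mem (fun i => thicken b {i} t)
      (List.mem_toFinset.2 hi)).trans Finset.subset_union_right)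
  have hgQ : ∀ i ∈ wQ, LocalisedOn YQ (g i) := fun i hi => (hgl i).mono
    (Finset.subset_biUnion_of_mem (fun i => thicken b {i} t) (List.mem_toFinset.2 hi))
  have hXO' : LocalisedOn XP O' := hXO.mono Finset.subset_union_left
  have hprodP := LocalisedOn.prod hgP
  have hprodQ := LocalisedOn.prod hgQ
  have hfact : wordExpect ψ g O' w =
      expect ψ (((wP.map g).prod * O') * ((wQ.map g).prod * 1)) := by
    rw [wordExpect, wordProd_filter (g := g) p fun i hi j hj hpi hpj => ?_, mul_one, mul_assoc,
      mul_assoc, (hXO'.commute hprodQ hdisj).eq]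
    exact ((hgP j (List.mem_filter.2 ⟨hj, by simp [hpj]⟩)).commute
      (hgQ i (List.mem_filter.2 ⟨hi, hpi⟩)) hdisj).symm
  have hcorr : ‖wordExpect ψ g O' w - wordExpect ψ g O' wP * wordExpect ψ g 1 wQ‖ ≤
      M * (2 * F * B ^ n * B ^ n) * E := by
    have h1 := hψ.decay XP YQ ((wP.map g).prod * O') ((wQ.map g).prod * 1) (q * t)
      (hprodP.mul hXO') (hprodQ.mul (LocalisedOn.one _)) fun i hi j hj => (hfar i hi j hj).le
    rw [hfact]
    refine h1.trans ?_
    have h2 : (XP.card : ℝ) + YQ.card ≤ k + (4 * (2 * n + 1) : ℕ) * ((t : ℝ) + 1) := by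
      exact_mod_cast hcard
    have h3 : Real.exp (a * ((XP.card : ℝ) + YQ.card)) ≤
        Real.exp (|a| * (k + (4 * (2 * n + 1) : ℕ) * ((t : ℝ) + 1))) := by
      rw [Real.exp_le_exp]
      calc a * ((XP.card : ℝ) + YQ.card) ≤ |a| * ((XP.card : ℝ) + YQ.card) := by
            gcongr; exact le_abs_self a
        _ ≤ _ := by gcongr
    have h4 := exp_mul_exp_le (k := k) (t := t) hξ hq
    have h5 := hbd g O' (2 * M) hgB (by positivity) hO'M wP hwPn
    have h6 := hbd g 1 1 hgB zero_le_one h1n wQ hwQn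
    calc c * Real.exp (a * ((XP.card : ℝ) + YQ.card)) * ‖(wP.map g).prod * O'‖ *
          ‖(wQ.map g).prod * 1‖ * Real.exp (-((q * t : ℕ) : ℝ) / ξ)
        ≤ |c| * Real.exp (|a| * (k + (4 * (2 * n + 1) : ℕ) * ((t : ℝ) + 1))) *
          (B ^ n * (2 * M)) * (B ^ n * 1) * Real.exp (-((q * t : ℕ) : ℝ) / ξ) := by
          gcongr
          exact le_abs_self c
      _ = |c| * (B ^ n * (2 * M)) * (B ^ n * 1) *
          (Real.exp (|a| * (k + (4 * (2 * n + 1) : ℕ) * ((t : ℝ) + 1))) *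
            Real.exp (-((q * t : ℕ) : ℝ) / ξ)) := by ring
      _ ≤ |c| * (B ^ n * (2 * M)) * (B ^ n * 1) *
          (Real.exp (|a| * ((k : ℝ) + (4 * (2 * n + 1) : ℕ))) * E) := by gcongr
      _ = _ := by rw [hF]; ring
  have hd1 := hdiff O O' M hM hOO' hO'M w hw
  have hd2 := hdiff O O' M hM hOO' hO'M wP hwPn
  have hd3 := hdiff 1 1 1 zero_le_one (by simp; positivity) (h1n.trans (by norm_num)) wQ hwQn
  have hb2 : ‖wordExpect ψ g O' wP‖ ≤ B ^ n * (2 * M) :=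
    (norm_expect_le hn _).trans (hbd g O' (2 * M) hgB (by positivity) hO'M wP hwPn)
  have hb3 : ‖wordExpect ψ h 1 wQ‖ ≤ B ^ n * 1 :=
    (norm_expect_le hn _).trans (hbd h 1 1 hhB zero_le_one h1n wQ hwQn)
  have hsplit : wordExpect ψ h O w - wordExpect ψ h O wP * wordExpect ψ h 1 wQ =
      (wordExpect ψ h O w - wordExpect ψ g O' w) +
      (wordExpect ψ g O' w - wordExpect ψ g O' wP * wordExpect ψ g 1 wQ) -
      ((wordExpect ψ h O wP - wordExpect ψ g O' wP) * wordExpect ψ h 1 wQ +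
        wordExpect ψ g O' wP * (wordExpect ψ h 1 wQ - wordExpect ψ g 1 wQ)) := by ring
  rw [hsplit]
  calc _ ≤ M * D * E + M * (2 * F * B ^ n * B ^ n) * E +
        (M * D * E * (B ^ n * 1) + B ^ n * (2 * M) * (1 * D * E)) := by
        refine (norm_sub_le _ _).trans (add_le_add ((norm_add_le _ _).trans (add_le_add hd1 hcorr))
          ((norm_add_le _ _).trans (add_le_add ?_ ?_)))
        · rw [norm_mul]; gcongr
        · rw [norm_mul]; gcongr
    _ = _ := by ring

/-- Connected expectation values of words decay exponentially with the distance of every letter. -/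
lemma exists_norm_connected_wordExpect_le (J μ c a ξ : ℝ) (hμ : 0 < μ) (hξ : 0 < ξ) (d n : ℕ) :
    ∃ N : ℕ, 0 < N ∧ ∀ k : ℕ, ∃ K : ℝ, 0 ≤ K ∧
      ∀ (b : Boundary) (L : ℕ) (h : Fin L → Op L d) (ψ : StateVec L d),
      IsQuasilocalDensity b J μ h → HasCorrelationLength b c a ξ ψ →
      ∀ (Z : Finset (Fin L)) (O : Op L d) (M : ℝ) (w : List (Fin L)),
        Z.Nonempty → ApproxLocal b μ k M Z O → w.length ≤ n →
        ‖connected (wordExpect ψ h 1) (wordExpect ψ h O) w‖ ≤ M * K ∧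
        ∀ i ∈ w, ‖connected (wordExpect ψ h 1) (wordExpect ψ h O) w‖ ≤
          M * (K * Real.exp (-(1 / (N * μ)) * distTo b Z i)) := by
  obtain ⟨q, hq⟩ := exists_norm_wordExpect_sub_le J μ c a ξ hμ hξ d n
  -- There must be room for `n` annuli of width `q * t` inside the distance of the far letter; the
  -- extra 1 makes the inequality strict for t > 0.
  refine ⟨n * q + 1, by omega, fun k => ?_⟩
  obtain ⟨K₁, hK₁, hfac⟩ := hq k
  set B : ℝ := (|J| + 1) ^ n with hB
  have hB0 : 0 ≤ B := by positivity
  obtain ⟨K₂, hK₂, hbd⟩ := exists_norm_connected_le n B hB0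
  obtain ⟨K₃, hK₃, hclus⟩ := exists_norm_connected_sub_le n B hB0
  set K₄ := K₂ + K₃ * K₁ with hK₄
  have he : 1 ≤ Real.exp (1 / μ) := Real.one_le_exp (by positivity)
  have hK₂₄ : K₂ ≤ K₄ := by rw [hK₄]; have := mul_nonneg hK₃ hK₁; linarith
  have hK₄0 : 0 ≤ K₄ := by positivity
  refine ⟨K₄ * Real.exp (1 / μ), by positivity, ?_⟩
  intro b L h ψ hh hψ Z O M w hZ hO hw
  have hM := hO.nonneg
  have hn := hψ.normalised
  have hwe : ∀ (A : Op L d) (m : ℝ), 0 ≤ m → ‖A‖ ≤ m → ∀ u, u.Sublist w →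
      ‖wordExpect ψ h A u‖ ≤ m * B := by
    intro A m hm hA u hu
    have hJ : ∀ i, ‖h i‖ ≤ |J| + 1 := fun i =>
      ((hh.bounded i).trans (le_abs_self J)).trans (by linarith)
    refine (norm_expect_le hn _).trans ((norm_wordProd_mul_le (by positivity) hJ A u).trans ?_)
    rw [mul_comm]
    have : (|J| + 1) ^ u.length ≤ B :=
      pow_le_pow_right₀ (by have := abs_nonneg J; linarith) (hu.length_le.trans hw)
    gcongr
  have hz := fun u hu => by simpa using hwe 1 1 zero_le_one (norm_one_le L d) u hu
  have hm := hwe O M hM hO.1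
  have htriv := hbd _ _ M w hM hw hz hm
  refine ⟨htriv.trans ?_, fun i hi => ?_⟩
  · gcongr
    nlinarith
  set D := distTo b Z i with hD
  set N := n * q + 1 with hN
  -- The largest range for which `N * t` stays below `D` when D > 0. Rounding loses at most one unit
  -- of `t`, which is the factor e^{1/μ} in the constant.
  set t := (D - 1) / N with ht
  have hN0 : 0 < N := by omega
  have hDt : D ≤ N * (t + 1) := by
    have h1 := Nat.lt_mul_div_succ (D - 1) hN0
    rw [← ht] at h1
    omega
  have hmain : ‖connected (wordExpect ψ h 1) (wordExpect ψ h O) w‖ ≤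
      M * (K₄ * Real.exp (-(t : ℝ) / μ)) := by
    rcases Nat.eq_zero_or_pos t with h0 | htpos
    · rw [h0]
      refine htriv.trans ?_
      simp only [Nat.cast_zero, neg_zero, zero_div, Real.exp_zero, mul_one]
      gcongr
    · have h1 : N * t ≤ D - 1 := Nat.mul_div_le _ _
      have h2 : 0 < D := by
        by_contra hc
        have : D = 0 := by omega
        rw [ht, this] at htpos
        simp at htpos
      have h3 : n * (q * t) < D := by
        have : N * t = n * (q * t) + t := by rw [hN]; ring
        omega
      obtain ⟨s, hsD, hs⟩ := exists_empty_annulus (distTo b Z) w hw hi h3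
      classical
      set p : Fin L → Bool := fun i => decide (i ∉ thicken b Z s) with hp
      have hp0 : ∀ i ∈ w, p i = false → i ∈ thicken b Z s := fun i _ hpi => by
        simpa [hp] using hpi
      have hp1 : ∀ i ∈ w, p i = true → i ∉ thicken b Z (s + q * t) := fun i hi hpi => by
        have h4 : i ∉ thicken b Z s := by simpa [hp] using hpi
        rw [mem_thicken_iff_distTo_le hZ] at h4 ⊢
        rcases hs i hi with h5 | h5 <;> omega
      -- The letter `i` lies beyond the empty annulus, so the factorised connected part vanishes and
      -- only the error remains.
      have hpi : w.filter p ≠ [] := List.ne_nil_of_mem (a := i) (List.mem_filter.2 ⟨hi, by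
        simp only [hp, decide_eq_true_eq]
        rw [mem_thicken_iff_distTo_le hZ]
        omega⟩)
      have hf : ∀ (A : Op L d) (m : ℝ), ApproxLocal b μ k m Z A → ∀ u : List (Fin L), u.Sublist w → _ :=
        fun A m hA u hu => hfac b L h ψ hh hψ Z A m t s u p hA (hu.length_le.trans hw)
          (fun j hj => hp0 j (hu.subset hj)) (fun j hj => hp1 j (hu.subset hj))
      have h6 := hclus p (wordExpect ψ h 1) (wordExpect ψ h O) M
        (K₁ * Real.exp (-(t : ℝ) / μ)) w hM (by positivity) hw
        (by simp [wordExpect, expect_one hn]) hz hm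
        (fun u hu => by simpa using hf 1 1 (ApproxLocal.one b μ k Z) u hu) (hf O M hO)
      rw [if_neg hpi, mul_zero, sub_zero] at h6
      refine h6.trans ?_
      rw [← mul_assoc K₃]
      gcongr
      rw [hK₄]; linarith
  refine hmain.trans ?_
  rw [mul_assoc K₄, ← Real.exp_add]
  gcongr
  have h1 : (D : ℝ) ≤ N * (t + 1) := by exact_mod_cast hDt
  have hNμ : 0 < (N : ℝ) * μ := by positivity
  have h2 : (1 / (N * μ)) * (D : ℝ) ≤ (t + 1) / μ := by
    calc (1 / (N * μ)) * (D : ℝ) ≤ (1 / (N * μ)) * (N * (t + 1)) := by gcongr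
      _ = (t + 1) / μ := by field_simp
  have h3 : -(t : ℝ) / μ = 1 / μ - (t + 1) / μ := by ring
  rw [h3]
  linarith

/-! ### Summable weights from the decay in the farthest letter -/

lemma pow_length_le_prod_exp {α : Type*} (f : α → ℕ) {κ : ℝ} (hκ : 0 ≤ κ) (D : ℕ) {w : List α}
    (h : ∀ i ∈ w, f i ≤ D) :
    Real.exp (-κ * D) ^ w.length ≤ (w.map fun i => Real.exp (-κ * f i)).prod := by
  induction w with
  | nil => simp
  | cons a w ih =>
    rw [List.length_cons, pow_succ', List.map_cons, List.prod_cons]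
    have h1 : (f a : ℝ) ≤ D := by exact_mod_cast h a (by simp)
    refine mul_le_mul ?_ (ih fun i hi => h i (by simp [hi])) (by positivity) (Real.exp_nonneg _)
    rw [Real.exp_le_exp]
    nlinarith

/-- Half of the decay in the farthest letter gives the factor in `r`; the other half is shared
equally among the letters, all of them at least as near. The product weight lets the sum over words
factorise into sums over one site. The `+ 1` keeps the rate meaningful for the empty word. -/
lemma le_prod_exp_of_forall_le {α : Type*} (f : α → ℕ) {C A κ : ℝ} (hA : 0 ≤ A) (hκ : 0 < κ)
    {w : List α} {r : ℕ} (h0 : C ≤ A) (h : ∀ i ∈ w, C ≤ A * Real.exp (-κ * f i))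
    (hr : r = 0 ∨ ∃ i ∈ w, r ≤ f i) :
    C ≤ A * Real.exp (-(κ / 2) * r) *
      (w.map fun i => Real.exp (-(κ / (2 * (w.length + 1))) * f i)).prod := by
  classical
  rcases eq_or_ne w [] with rfl | hw
  · obtain rfl : r = 0 := by simpa using hr
    simpa using h0
  obtain ⟨i, hi, hmax⟩ := w.toFinset.exists_max_image f
    (by rw [List.toFinset_nonempty_iff]; exact hw)
  simp only [List.mem_toFinset] at hi hmax
  have hri : (r : ℝ) ≤ f i := by
    rcases hr with rfl | ⟨j, hj, hrj⟩
    · simp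
    · exact_mod_cast hrj.trans (hmax j hj)
  refine (h i hi).trans ?_
  have hl : (0 : ℝ) < 2 * (w.length + 1) := by positivity
  have h1 := pow_length_le_prod_exp f (κ := κ / (2 * (w.length + 1))) (by positivity) (f i) hmax
  have h2 : Real.exp (-(κ / 2) * f i) ≤
      Real.exp (-(κ / (2 * (w.length + 1))) * f i) ^ w.length := by
    rw [← Real.exp_nat_mul, Real.exp_le_exp]
    have h3 : κ / (2 * (w.length + 1)) * w.length ≤ κ / 2 := by
      rw [div_mul_eq_mul_div, div_le_div_iff₀ hl (by norm_num)]
      nlinarith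
    have h4 := mul_le_mul_of_nonneg_right h3 (Nat.cast_nonneg (α := ℝ) (f i))
    linarith
  calc A * Real.exp (-κ * f i)
      = A * Real.exp (-(κ / 2) * f i) * Real.exp (-(κ / 2) * f i) := by
        rw [mul_assoc, ← Real.exp_add]; ring_nf
    _ ≤ A * Real.exp (-(κ / 2) * r) * (w.map fun i =>
        Real.exp (-(κ / (2 * (w.length + 1))) * f i)).prod := by
        refine mul_le_mul ?_ (h2.trans h1) (Real.exp_nonneg _) (by positivity)
        refine mul_le_mul_of_nonneg_left ?_ hA
        rw [Real.exp_le_exp]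
        nlinarith

/-- Bounds on the correlations with an approximately local operator, and on the effect of a
truncation of the Hamiltonian. -/
lemma exists_norm_ratioDeriv_le (J μ c a ξ : ℝ) (hμ : 0 < μ) (hξ : 0 < ξ) (d n : ℕ) :
    ∃ κ : ℝ, 0 < κ ∧ ∀ k : ℕ, ∃ K : ℝ,
      ∀ (b : Boundary) (L : ℕ) (h : Fin L → Op L d) (ψ : StateVec L d),
      IsQuasilocalDensity b J μ h → HasCorrelationLength b c a ξ ψ →
      ∀ (Z : Finset (Fin L)) (O : Op L d) (M : ℝ),
        Z.Nonempty → Z.card ≤ k → ApproxLocal b μ k M Z O →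
        ‖ratioDeriv ψ (hamiltonian h Finset.univ) O n‖ ≤ K * M ∧
        ∀ (S : Finset (Fin L)) (r : ℕ), thicken b Z r ⊆ S →
          ‖ratioDeriv ψ (hamiltonian h Finset.univ) O n - ratioDeriv ψ (hamiltonian h S) O n‖ ≤
            K * M * Real.exp (-κ * r) := by
  obtain ⟨N, hN, hcl⟩ := exists_norm_connected_wordExpect_le J μ c a ξ hμ hξ d n
  set lam : ℝ := 1 / (N * μ) with hlam
  have hlam0 : 0 < lam := by positivity
  refine ⟨lam / 2, by positivity, fun k => ?_⟩
  obtain ⟨K, hK, hcl⟩ := hcl k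
  set κ : ℝ := lam / (2 * (n + 1)) with hκ
  have hκ0 : 0 < κ := by positivity
  set G : ℝ := 4 * (1 - Real.exp (-κ))⁻¹ with hG
  have hG0 : 0 ≤ G := by
    have : Real.exp (-κ) ≤ 1 := by rw [Real.exp_le_one_iff]; linarith
    have : 0 ≤ 1 - Real.exp (-κ) := by linarith
    positivity
  refine ⟨K * (k * G) ^ n, ?_⟩
  intro b L h ψ hh hψ Z O M hZ hZk hO
  have hM := hO.nonneg
  set C := connected (wordExpect ψ h 1) (wordExpect ψ h O) with hC
  have hword : ∀ (w : List (Fin L)) (r : ℕ), w.length = n →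
      (r = 0 ∨ ∃ i ∈ w, r ≤ distTo b Z i) →
      ‖C w‖ ≤ M * K * Real.exp (-(lam / 2) * r) *
        (w.map fun i => Real.exp (-κ * distTo b Z i)).prod := by
    intro w r hw hr
    obtain ⟨h1, h2⟩ := hcl b L h ψ hh hψ Z O M w hZ hO hw.le
    have h3 := le_prod_exp_of_forall_le (distTo b Z) (mul_nonneg hM hK) hlam0 h1
      (fun i hi => by rw [mul_assoc]; exact h2 i hi) hr
    rwa [hw] at h3
  have hsum : ∀ r : ℕ, wordSum Finset.univ n (fun w => M * K * Real.exp (-(lam / 2) * r) *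
      (w.map fun i => Real.exp (-κ * distTo b Z i)).prod) ≤
      K * (k * G) ^ n * M * Real.exp (-(lam / 2) * r) := by
    intro r
    rw [wordSum_const_mul, wordSum_prod]
    have h1 : ∑ i, Real.exp (-κ * distTo b Z i) ≤ k * G :=
      (sum_exp_distTo_le b hZ hκ0).trans (by gcongr)
    have h0 : 0 ≤ ∑ i, Real.exp (-κ * distTo b Z i) :=
      Finset.sum_nonneg fun i _ => Real.exp_nonneg _
    calc _ ≤ M * K * Real.exp (-(lam / 2) * r) * (k * G) ^ n := by gcongr
      _ = _ := by ring
  refine ⟨?_, fun S r hS => ?_⟩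
  · rw [ratioDeriv_eq_wordSum hψ.normalised]
    have h1 := (norm_wordSum_le (f := C) Finset.univ n
      fun w hw _ => hword w 0 hw (Or.inl rfl)).trans (hsum 0)
    simpa using h1
  · classical
    rw [ratioDeriv_eq_wordSum hψ.normalised, ratioDeriv_eq_wordSum hψ.normalised,
      wordSum_subset (Finset.subset_univ S), ← wordSum_sub]
    -- Words inside `S` cancel; every other word has a letter outside the `r`-neighbourhood of `Z`.
    refine (norm_wordSum_le Finset.univ n fun w hw _ => ?_).trans (hsum r)
    by_cases hall : ∀ i ∈ w, i ∈ S
    · rw [if_pos hall, sub_self, norm_zero]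
      have : 0 ≤ (w.map fun i => Real.exp (-κ * distTo b Z i)).prod :=
        List.prod_nonneg fun x hx => by
          obtain ⟨i, _, rfl⟩ := List.mem_map.1 hx
          exact Real.exp_nonneg _
      positivity
    · rw [if_neg hall, sub_zero]
      push Not at hall
      obtain ⟨i, hi, hiS⟩ := hall
      refine hword w r hw (Or.inr ⟨i, hi, ?_⟩)
      have h1 := mt (@hS i) hiS
      rw [mem_thicken_iff_distTo_le hZ] at h1
      omega

/-! ### Consequences for quasilocal energy densities -/

/-- The energy cumulants are sums of bounded cumulant densities. -/
theorem exists_cumulant_eq_sum (d : ℕ) (J μ c a ξ : ℝ) (hμ : 0 < μ) (hξ : 0 < ξ) (n : ℕ)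
    (hn : 1 ≤ n) : ∃ K : ℝ, ∀ (b : Boundary) (L : ℕ) (h : Fin L → Op L d) (ψ : StateVec L d),
      IsQuasilocalDensity b J μ h → HasCorrelationLength b c a ξ ψ →
      cumulant ψ (hamiltonian h Finset.univ) (n + 1) =
          ∑ l, connCorr ψ (dressed ψ (hamiltonian h Finset.univ) n) (h l) ∧
        ∀ l, ‖connCorr ψ (dressed ψ (hamiltonian h Finset.univ) n) (h l)‖ ≤ K := by
  obtain ⟨κ, -, hK⟩ := exists_norm_ratioDeriv_le J μ c a ξ hμ hξ d n
  obtain ⟨K, hK⟩ := hK 1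
  refine ⟨K * J, fun b L h ψ hh hψ => ?_⟩
  have h1 : ∀ O, connCorr ψ (dressed ψ (hamiltonian h Finset.univ) n) O =
      ratioDeriv ψ (hamiltonian h Finset.univ) O n := fun O => by
    rw [connCorr_dressed hψ.normalised, if_neg (by omega)]
  simp only [h1]
  refine ⟨?_, fun l => (hK b L h ψ hh hψ {l} (h l) J (Finset.singleton_nonempty l) (by simp)
    (ApproxLocal.of_density 1 hh l)).1⟩
  rw [cumulant_succ hψ.normalised, ← ratioDeriv_sum hψ.normalised]
  rfl

/-- Extensivity of the energy cumulants of a quasilocal energy density. -/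
theorem exists_norm_cumulant_le (d : ℕ) (J μ c a ξ : ℝ) (hμ : 0 < μ) (hξ : 0 < ξ) (n : ℕ) :
    ∃ K : ℝ, ∀ (b : Boundary) (L : ℕ) (h : Fin L → Op L d) (ψ : StateVec L d),
      IsQuasilocalDensity b J μ h → HasCorrelationLength b c a ξ ψ →
      ‖cumulant ψ (hamiltonian h Finset.univ) n‖ ≤ K * (L : ℝ) := by
  rcases n with _ | n
  · exact ⟨0, fun b L h ψ _ hψ => by simp [cumulant_zero hψ.normalised]⟩
  obtain ⟨κ, -, hK⟩ := exists_norm_ratioDeriv_le J μ c a ξ hμ hξ d n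
  obtain ⟨K, hK⟩ := hK 1
  refine ⟨K * J, fun b L h ψ hh hψ => ?_⟩
  rw [cumulant_succ hψ.normalised]
  conv_lhs => rw [show ratioDeriv ψ (hamiltonian h Finset.univ) (hamiltonian h Finset.univ) n =
    ∑ l, ratioDeriv ψ (hamiltonian h Finset.univ) (h l) n from
      ratioDeriv_sum hψ.normalised _ _ _ _]
  refine (norm_sum_le _ _).trans ((Finset.sum_le_sum fun l _ =>
    (hK b L h ψ hh hψ {l} (h l) J (Finset.singleton_nonempty l) (by simp)
      (ApproxLocal.of_density 1 hh l)).1).trans ?_)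
  simp [mul_comm]

/-- Connected correlations with a localised operator are exponentially close to truncated ones. -/
theorem exists_norm_connCorr_sub_le (d : ℕ) (J μ c a ξ : ℝ) (hμ : 0 < μ) (hξ : 0 < ξ) (n : ℕ) :
    ∃ κ : ℝ, 0 < κ ∧ ∀ k : ℕ, ∃ K : ℝ,
      ∀ (b : Boundary) (L : ℕ) (h : Fin L → Op L d) (ψ : StateVec L d),
      IsQuasilocalDensity b J μ h → HasCorrelationLength b c a ξ ψ →
      ∀ (Z S : Finset (Fin L)) (O : Op L d) (r : ℕ),
        LocalisedOn Z O → Z.card ≤ k → thicken b Z r ⊆ S →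
        ‖connCorr ψ (dressed ψ (hamiltonian h Finset.univ) n) O -
            connCorr ψ (dressed ψ (hamiltonian h S) n) O‖ ≤ K * ‖O‖ * Real.exp (-κ * (r : ℝ)) := by
  obtain ⟨κ, hκ, hK⟩ := exists_norm_ratioDeriv_le J μ c a ξ hμ hξ d n
  refine ⟨κ, hκ, fun k => ?_⟩
  obtain ⟨K, hK⟩ := hK k
  refine ⟨max K 0, fun b L h ψ hh hψ Z S O r hO hZ hS => ?_⟩
  have hn := hψ.normalised
  have hnn : 0 ≤ max K 0 * ‖O‖ * Real.exp (-κ * (r : ℝ)) := by positivity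
  rw [connCorr_dressed hn, connCorr_dressed hn]
  split_ifs with h0
  · simpa using hnn
  -- The distance to an empty set carries no information, but an operator localised there is a
  -- scalar and both correlations vanish.
  rcases Z.eq_empty_or_nonempty with rfl | hZn
  · obtain ⟨z, hO1⟩ := hO.exists_eq_smul_one
    rw [hO1, ratioDeriv_smul_one hn, ratioDeriv_smul_one hn, if_neg h0, sub_self, norm_zero,
      ← hO1]
    exact hnn
  · refine ((hK b L h ψ hh hψ Z O ‖O‖ hZn hZ (ApproxLocal.of_localisedOn hO hZ)).2 S r hS).trans ?_
    gcongr
    exact le_max_left K 0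

/-! ### Quasilocalisation of the truncated operators -/

/-- Differentiating ⟨e^{βH}⟩ · ⟨e^{βH}⟩⁻¹ = 1 expresses each derivative of the inverse through lower
ones and the moments, which are bounded by powers of `B`. -/
lemma exists_norm_iteratedDeriv_genZ_inv_le (n : ℕ) (B : ℝ) (hB : 0 ≤ B) : ∃ K : ℝ, 0 ≤ K ∧
    ∀ (L d : ℕ) (ψ : StateVec L d) (H : Op L d), star ψ ⬝ᵥ ψ = 1 → ‖H‖ ≤ B →
      ‖iteratedDeriv n (fun β => (genZ ψ H β)⁻¹) 0‖ ≤ K := by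
  have key : ∀ (L d : ℕ) (ψ : StateVec L d) (H : Op L d), star ψ ⬝ᵥ ψ = 1 → ‖H‖ ≤ B → ∀ i,
      ‖expect ψ (H ^ i)‖ ≤ B ^ i := by
    intro L d ψ H hψ hH i
    refine (norm_expect_le hψ _).trans ?_
    induction i with
    | zero => simpa using norm_one_le L d
    | succ i ih =>
      rw [pow_succ, pow_succ]
      exact (norm_mul_le _ _).trans (mul_le_mul ih hH (norm_nonneg _) (by positivity))
  induction n using Nat.strong_induction_on with
  | _ n ih =>
    choose! K hK0 hK using ih
    refine ⟨1 + ∑ i ∈ Finset.range n, (n.choose (i + 1) : ℝ) * B ^ (i + 1) * K (n - (i + 1)),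
      add_nonneg zero_le_one (Finset.sum_nonneg fun i hi => ?_), fun L d ψ H hψ hH => ?_⟩
    · have := hK0 (n - (i + 1)) (by have := Finset.mem_range.1 hi; omega)
      positivity
    have h1 : (fun β => genZ ψ H β * (genZ ψ H β)⁻¹) =ᶠ[nhds 0] fun _ => (1 : ℂ) := by
      filter_upwards [eventually_genZ_mem_slitPlane hψ H] with β hβ
      exact mul_inv_cancel₀ (Complex.slitPlane_ne_zero hβ)
    have h2 := h1.iteratedDeriv_eq n
    rw [iteratedDeriv_fun_mul (contDiff_genZ ψ H n).contDiffAt (contDiffAt_genZ_inv hψ H n),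
      iteratedDeriv_const, Finset.sum_range_succ'] at h2
    simp only [genZ_eq_genNum, iteratedDeriv_genNum, mul_one, pow_zero, expect_one hψ,
      Nat.choose_zero_right, Nat.cast_one, Nat.sub_zero] at h2
    rw [one_mul] at h2
    rw [genZ_eq_genNum, eq_sub_of_add_eq' h2]
    refine (norm_sub_le _ _).trans (add_le_add (by split_ifs <;> simp)
      ((norm_sum_le _ _).trans (Finset.sum_le_sum fun i hi => ?_)))
    rw [norm_mul, norm_mul, Complex.norm_natCast]
    have h3 := hK (n - (i + 1)) (by have := Finset.mem_range.1 hi; omega) L d ψ H hψ hH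
    rw [genZ_eq_genNum] at h3
    have h4 := key L d ψ H hψ hH (i + 1)
    gcongr

/-- Leibniz rule; the term i = n drops out because e^{βH} - 1 vanishes at β = 0. -/
lemma dressed_eq_sum {ψ : StateVec L d} (hψ : star ψ ⬝ᵥ ψ = 1) (H : Op L d) (n : ℕ) :
    dressed ψ H n = ∑ i ∈ Finset.range n, ((n.choose i : ℂ) *
      iteratedDeriv i (fun β => (genZ ψ H β)⁻¹) 0) • H ^ (n - i) := by
  have hE : ∀ m : ℕ, ContDiffAt ℝ m (fun t : ℝ => NormedSpace.exp ((t : ℂ) • H) - 1) 0 := by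
    intro m
    have := contDiff_exp_ofReal_smul_mul H 1 m
    simp only [mul_one] at this
    exact (this.sub contDiff_const).contDiffAt
  have hder : ∀ m, iteratedDeriv m (fun t : ℝ => NormedSpace.exp ((t : ℂ) • H) - 1) 0 =
      if m = 0 then 0 else H ^ m := by
    intro m
    have h1 := iteratedDeriv_exp_ofReal_smul H 1 m
    simp only [mul_one] at h1
    have h2 := contDiff_exp_ofReal_smul_mul H 1 m
    simp only [mul_one] at h2
    rw [iteratedDeriv_fun_sub h2.contDiffAt contDiff_const.contDiffAt, h1, iteratedDeriv_const]
    split_ifs with hm <;> simp [hm]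
  have h := iteratedDerivWithin_smul (Set.mem_univ (0 : ℝ)) uniqueDiffOn_univ
    (contDiffAt_genZ_inv hψ H n).contDiffWithinAt (hE n).contDiffWithinAt
  simp only [iteratedDerivWithin_univ] at h
  rw [dressed]
  refine h.trans ?_
  rw [Finset.sum_range_succ]
  simp only [hder, Nat.sub_self, if_true, smul_zero, add_zero]
  refine Finset.sum_congr rfl fun i hi => ?_
  rw [if_neg (by have := Finset.mem_range.1 hi; omega), ← Nat.cast_smul_eq_nsmul ℂ, smul_smul]

lemma norm_pow_sub_pow_le {A B : Op L d} {R ε : ℝ} (hA : ‖A‖ ≤ R) (hB : ‖B‖ ≤ R)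
    (hAB : ‖A - B‖ ≤ ε) (hR : 0 ≤ R) (m : ℕ) : ‖A ^ m - B ^ m‖ ≤ m * R ^ (m - 1) * ε := by
  have hpow : ∀ m, ‖B ^ m‖ ≤ R ^ m := fun m => by
    induction m with
    | zero => simpa using norm_one_le L d
    | succ m ih =>
      rw [pow_succ, pow_succ]
      exact (norm_mul_le _ _).trans (mul_le_mul ih hB (norm_nonneg _) (by positivity))
  have hε : 0 ≤ ε := (norm_nonneg _).trans hAB
  induction m with
  | zero => simp
  | succ m ih =>
    have h1 : A ^ (m + 1) - B ^ (m + 1) = A * (A ^ m - B ^ m) + (A - B) * B ^ m := by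
      rw [pow_succ', pow_succ']; noncomm_ring
    rw [h1]
    calc _ ≤ R * (m * R ^ (m - 1) * ε) + ε * R ^ m :=
          (norm_add_le _ _).trans (add_le_add
            ((norm_mul_le _ _).trans (mul_le_mul hA ih (norm_nonneg _) hR))
            ((norm_mul_le _ _).trans (mul_le_mul hAB (hpow m) (norm_nonneg _) hε)))
      _ = _ := by
          rcases m with _ | m
          · simp
          · simp only [Nat.add_sub_cancel]; push_cast; ring

/-- The truncated operators are quasilocalised about the truncation region. -/
theorem exists_quasilocalisedAbout_dressed (d : ℕ) (J μ c a ξ : ℝ) (hμ : 0 < μ) (n k : ℕ) :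
    ∃ K : ℝ, ∀ (b : Boundary) (L : ℕ) (h : Fin L → Op L d) (ψ : StateVec L d),
      IsQuasilocalDensity b J μ h → HasCorrelationLength b c a ξ ψ →
      ∀ S : Finset (Fin L), S.card ≤ k →
        QuasilocalisedAbout b K μ S (dressed ψ (hamiltonian h S) n) := by
  set R : ℝ := 2 * (k * |J|) with hR
  have hR0 : 0 ≤ R := by positivity
  choose Q hQ0 hQ using fun i => exists_norm_iteratedDeriv_genZ_inv_le i R hR0
  refine ⟨∑ i ∈ Finset.range n, ((n.choose i : ℝ) * Q i) *
    ((n - i : ℕ) * R ^ (n - i - 1) * (k * |J|)), fun b L h ψ hh hψ S hS r => ?_⟩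
  have hn := hψ.normalised
  choose g hgl hgn using fun i => hh.quasilocalised i r
  set E : ℝ := Real.exp (-(r : ℝ) / μ) with hE
  have hE1 : E ≤ 1 := by
    rw [hE, Real.exp_le_one_iff, neg_div]
    have : 0 ≤ (r : ℝ) / μ := by positivity
    linarith
  have hE0 : 0 ≤ E := Real.exp_nonneg _
  set H := hamiltonian h S with hH
  set G := hamiltonian g S with hG
  have hSk : (S.card : ℝ) ≤ k := by exact_mod_cast hS
  have hHn : ‖H‖ ≤ k * |J| := by
    refine (norm_sum_le _ _).trans ((Finset.sum_le_sum fun i _ =>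
      (hh.bounded i).trans (le_abs_self J)).trans ?_)
    rw [Finset.sum_const, nsmul_eq_mul]
    gcongr
  have hHG : ‖H - G‖ ≤ k * |J| * E := by
    rw [hH, hG, hamiltonian, hamiltonian, ← Finset.sum_sub_distrib]
    refine (norm_sum_le _ _).trans ((Finset.sum_le_sum fun i _ => (hgn i).trans
      (mul_le_mul_of_nonneg_right (le_abs_self J) hE0)).trans ?_)
    rw [Finset.sum_const, nsmul_eq_mul, mul_assoc]
    gcongr
  have hkJ : 0 ≤ k * |J| := by positivity
  have hHR : ‖H‖ ≤ R := by linarith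
  have hGR : ‖G‖ ≤ R := by
    have h1 := norm_sub_norm_le G H
    rw [norm_sub_rev] at h1
    nlinarith
  have hGl : LocalisedOn (thicken b S r) G := LocalisedOn.sum S fun i hi =>
    (hgl i).mono (thicken_subset_thicken (Finset.singleton_subset_iff.2 hi) r)
  -- The approximant is the same polynomial in the localised `G`. The coefficients remain those of
  -- `H`: as scalars they do not affect localisation.
  refine ⟨∑ i ∈ Finset.range n, ((n.choose i : ℂ) *
    iteratedDeriv i (fun β => (genZ ψ H β)⁻¹) 0) • G ^ (n - i),
    LocalisedOn.sum _ fun i _ => (hGl.pow _).smul _, ?_⟩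
  rw [dressed_eq_sum hn, ← Finset.sum_sub_distrib, Finset.sum_mul]
  refine (norm_sum_le _ _).trans (Finset.sum_le_sum fun i _ => ?_)
  rw [← smul_sub, norm_smul, norm_mul, Complex.norm_natCast, mul_assoc _ _ E, mul_assoc _ _ E]
  have h1 := norm_pow_sub_pow_le hHR hGR hHG hR0 (n - i)
  have h2 := hQ i L d ψ H hn hHR
  have h3 := hQ0 i
  gcongr

/-! ### Averages over a site -/

/-- Cauchy–Schwarz over `k`, with ∑ ‖V_k x‖² = s ‖x‖². This gives the contractivity of site averages
without a loss of powers of `d`, which repeated averaging over a long chain would compound. -/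
lemma norm_sum_adjoint_mul_mul_le {E ι : Type*} [NormedAddCommGroup E] [InnerProductSpace ℂ E]
    [CompleteSpace E] [Fintype ι] (V : ι → E →L[ℂ] E) (A : E →L[ℂ] E) {s : ℝ} (hs : 0 ≤ s)
    (hV : ∑ k, star (V k) * V k = (s : ℂ) • 1) : ‖∑ k, star (V k) * A * V k‖ ≤ s * ‖A‖ := by
  have hsq : ∀ x, ∑ k, ‖V k x‖ ^ 2 = s * ‖x‖ ^ 2 := by
    intro x
    have h1 : ∀ k, ((‖V k x‖ ^ 2 : ℝ) : ℂ) = inner ℂ x ((star (V k) * V k) x) := fun k => by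
      rw [mul_apply_eq_comp, ContinuousLinearMap.star_eq_adjoint,
        ContinuousLinearMap.adjoint_inner_right, inner_self_eq_norm_sq_to_K]
      simp
    have h2 : ((∑ k, ‖V k x‖ ^ 2 : ℝ) : ℂ) = ((s * ‖x‖ ^ 2 : ℝ) : ℂ) := by
      rw [Complex.ofReal_sum, Finset.sum_congr rfl fun k _ => h1 k, ← inner_sum,
        ← sum_apply, hV]
      rw [smul_apply, one_apply_eq_self, inner_smul_right,
        inner_self_eq_norm_sq_to_K]
      simp
    exact_mod_cast h2
  refine ContinuousLinearMap.opNorm_le_bound _ (by positivity) fun y => ?_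
  set x := (∑ k, star (V k) * A * V k) y with hx
  have h1 : inner ℂ x x = ∑ k, inner ℂ (V k x) (A (V k y)) := by
    have hxx : inner ℂ x x = inner ℂ x (∑ k, (star (V k) * A * V k) y) := by
      rw [hx, sum_apply]
    rw [hxx, inner_sum]
    refine Finset.sum_congr rfl fun k _ => ?_
    rw [mul_apply_eq_comp, mul_apply_eq_comp,
      ContinuousLinearMap.star_eq_adjoint, ContinuousLinearMap.adjoint_inner_right]
  have h2 : ‖x‖ ^ 2 ≤ ‖A‖ * ∑ k, ‖V k x‖ * ‖V k y‖ := by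
    have h3 : ‖(inner ℂ x x : ℂ)‖ = ‖x‖ ^ 2 := by
      rw [inner_self_eq_norm_sq_to_K]; simp
    rw [← h3, h1, Finset.mul_sum]
    refine (norm_sum_le _ _).trans (Finset.sum_le_sum fun k _ => ?_)
    calc _ ≤ ‖V k x‖ * ‖A (V k y)‖ := norm_inner_le_norm _ _
      _ ≤ ‖V k x‖ * (‖A‖ * ‖V k y‖) := by gcongr; exact A.le_opNorm _
      _ = _ := by ring
  have h3 : ∑ k, ‖V k x‖ * ‖V k y‖ ≤ s * (‖x‖ * ‖y‖) := by
    have h4 := Finset.sum_mul_sq_le_sq_mul_sq Finset.univ (fun k => ‖V k x‖) (fun k => ‖V k y‖)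
    rw [hsq, hsq] at h4
    refine abs_le_of_sq_le_sq' ?_ (by positivity) |>.2
    calc _ ≤ _ := h4
      _ = _ := by ring
  have h4 : ‖x‖ * ‖x‖ ≤ (s * ‖A‖ * ‖y‖) * ‖x‖ := by
    calc ‖x‖ * ‖x‖ = ‖x‖ ^ 2 := by ring
      _ ≤ ‖A‖ * (s * (‖x‖ * ‖y‖)) := h2.trans (by gcongr)
      _ = _ := by ring
  rcases (norm_nonneg x).eq_or_lt with h0 | h0
  · rw [← h0]; positivity
  · exact le_of_mul_le_mul_right h4 h0

lemma norm_sum_conjTranspose_mul_mul_le {ι : Type*} [Fintype ι] (V : ι → Op L d) (A : Op L d)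
    {s : ℝ} (hs : 0 ≤ s) (hV : ∑ k, (V k)ᴴ * V k = (s : ℂ) • 1) :
    ‖∑ k, (V k)ᴴ * A * V k‖ ≤ s * ‖A‖ := by
  have h := norm_sum_adjoint_mul_mul_le
    (fun k => Matrix.toEuclideanCLM (n := Config L d) (𝕜 := ℂ) (V k))
    (Matrix.toEuclideanCLM (n := Config L d) (𝕜 := ℂ) A) hs (by
      have := congrArg (Matrix.toEuclideanCLM (n := Config L d) (𝕜 := ℂ)) hV
      simpa only [map_sum, map_mul, map_smul, map_one, ← Matrix.star_eq_conjTranspose, map_star]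
        using this)
  have h2 := Matrix.cstar_norm_def (𝕜 := ℂ) (∑ k, (V k)ᴴ * A * V k)
  rw [h2, Matrix.cstar_norm_def (𝕜 := ℂ) A]
  simpa only [map_sum, map_mul, ← Matrix.star_eq_conjTranspose, map_star] using h

/-- The matrix unit `|x⟩⟨y|` at the site `l`. -/
def siteUnit (l : Fin L) (x y : Fin d) : Op L d :=
  Matrix.of fun σ τ => if σ l = x ∧ τ = Function.update σ l y then 1 else 0

lemma siteUnit_mul_apply (l : Fin L) (x y : Fin d) (A : Op L d) (σ τ : Config L d) :
    (siteUnit l x y * A) σ τ = if σ l = x then A (Function.update σ l y) τ else 0 := by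
  simp only [Matrix.mul_apply, siteUnit, Matrix.of_apply, ite_mul, one_mul, zero_mul]
  split_ifs with h <;> simp [h]

lemma eq_update_and_iff (l : Fin L) (x y : Fin d) (σ τ : Config L d) :
    (σ l = x ∧ τ = Function.update σ l y) ↔ (τ l = y ∧ σ = Function.update τ l x) := by
  constructor <;> rintro ⟨rfl, rfl⟩ <;> simp

lemma mul_siteUnit_apply (l : Fin L) (x y : Fin d) (A : Op L d) (σ τ : Config L d) :
    (A * siteUnit l x y) σ τ = if τ l = y then A σ (Function.update τ l x) else 0 := by
  simp only [Matrix.mul_apply, siteUnit, Matrix.of_apply, eq_update_and_iff l x y, mul_ite,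
    mul_one, mul_zero]
  split_ifs with h <;> simp [h]

lemma conjTranspose_siteUnit (l : Fin L) (x y : Fin d) :
    (siteUnit l x y)ᴴ = siteUnit l y x := by
  ext σ τ
  rw [Matrix.conjTranspose_apply, siteUnit, siteUnit, Matrix.of_apply, Matrix.of_apply]
  simp only [eq_update_and_iff l x y τ σ]
  split_ifs <;> simp

lemma siteUnit_mul_siteUnit (l : Fin L) (x y z : Fin d) :
    siteUnit l x y * siteUnit l y z = siteUnit l x z := by
  ext σ τ
  rw [siteUnit_mul_apply]
  simp only [siteUnit, Matrix.of_apply, Function.update_self, Function.update_idem, true_and]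
  split_ifs <;> simp_all

/-- By the C*-identity ‖E_xy‖² = ‖E_yy‖, and in particular ‖E_yy‖² = ‖E_yy‖. -/
lemma norm_siteUnit_le (l : Fin L) (x y : Fin d) : ‖siteUnit l x y‖ ≤ 1 := by
  have key : ∀ x y : Fin d, ‖siteUnit l x y‖ * ‖siteUnit l x y‖ = ‖siteUnit l y y‖ := fun x y => by
    rw [← CStarRing.norm_star_mul_self, Matrix.star_eq_conjTranspose, conjTranspose_siteUnit,
      siteUnit_mul_siteUnit]
  have h1 := key x y
  have h2 := key y y
  have h3 : ‖siteUnit l y y‖ ≤ 1 := by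
    by_contra hc
    push Not at hc
    nlinarith
  nlinarith [norm_nonneg (siteUnit l x y)]

lemma localisedOn_siteUnit (l : Fin L) (x y : Fin d) : LocalisedOn {l} (siteUnit l x y) := by
  refine ⟨Matrix.of fun σ τ => if σ ⟨l, by simp⟩ = x ∧ τ ⟨l, by simp⟩ = y then 1 else 0,
    fun σ τ h => ?_, fun σ τ h => ?_⟩
  · simp only [siteUnit, Matrix.of_apply]
    refine if_congr (and_congr_right fun _ => ⟨fun h1 => by simp [h1], fun h1 => ?_⟩) rfl rfl
    funext i
    by_cases hi : i = l
    · subst hi; simpa using h1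
    · rw [Function.update_of_ne hi, h i (by simpa using hi)]
  · obtain ⟨i, hi, hne⟩ := h
    rw [siteUnit, Matrix.of_apply, if_neg]
    rintro ⟨-, rfl⟩
    rw [Function.update_of_ne (by simpa using hi)] at hne
    exact hne rfl

lemma sum_siteUnit_mul_siteUnit (l : Fin L) :
    ∑ q : Fin d × Fin d, siteUnit l q.1 q.2 * siteUnit l q.2 q.1 = (d : ℂ) • (1 : Op L d) := by
  simp only [siteUnit_mul_siteUnit]
  ext σ τ
  rw [Matrix.sum_apply, Fintype.sum_prod_type, Finset.sum_comm, Matrix.smul_apply,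
    Matrix.one_apply, smul_eq_mul, ← nsmul_eq_mul, Finset.sum_eq_card_nsmul fun y _ => ?_,
    Finset.card_univ, Fintype.card_fin]
  simp only [siteUnit, Matrix.of_apply]
  rw [Finset.sum_eq_single (σ l)]
  · simp [eq_comm]
  · intro x _ hx
    simp [hx.symm]
  · simp

/-- The average of an operator over the site `l`: its normalised partial trace. -/
noncomputable def siteAverage (l : Fin L) (A : Op L d) : Op L d :=
  (d : ℂ)⁻¹ • ∑ q : Fin d × Fin d, siteUnit l q.1 q.2 * A * siteUnit l q.2 q.1

lemma siteAverage_apply (l : Fin L) (A : Op L d) (σ τ : Config L d) :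
    siteAverage l A σ τ = if σ l = τ l then
      (d : ℂ)⁻¹ * ∑ y, A (Function.update σ l y) (Function.update τ l y) else 0 := by
  rw [siteAverage, Matrix.smul_apply, Matrix.sum_apply, Fintype.sum_prod_type]
  simp only [mul_siteUnit_apply, siteUnit_mul_apply, smul_eq_mul]
  rw [Finset.sum_comm]
  split_ifs with h
  · congr 1
    refine Finset.sum_congr rfl fun y _ => ?_
    simp [h]
  · rw [Finset.sum_eq_zero, mul_zero]
    intro y _
    refine Finset.sum_eq_zero fun x _ => ?_
    split_ifs with h1 h2
    · exact absurd (h2.trans h1.symm) h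
    · rfl
    · rfl

lemma siteAverage_sub (l : Fin L) (A B : Op L d) :
    siteAverage l (A - B) = siteAverage l A - siteAverage l B := by
  simp only [siteAverage, mul_sub, sub_mul, Finset.sum_sub_distrib, smul_sub]

lemma siteAverage_mul_left (l : Fin L) {A B : Op L d}
    (h : ∀ x y, Commute (siteUnit l x y) B) : siteAverage l (B * A) = B * siteAverage l A := by
  simp only [siteAverage, mul_smul_comm, Finset.mul_sum]
  congr 1
  refine Finset.sum_congr rfl fun q _ => ?_
  rw [← mul_assoc, (h q.1 q.2).eq]
  simp only [mul_assoc]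

lemma siteAverage_mul_right (l : Fin L) {A B : Op L d}
    (h : ∀ x y, Commute (siteUnit l x y) B) : siteAverage l (A * B) = siteAverage l A * B := by
  rw [siteAverage, siteAverage, smul_mul_assoc, Finset.sum_mul]
  refine congrArg _ (Finset.sum_congr rfl fun q _ => ?_)
  rw [mul_assoc (_ * A) _ B, (h q.2 q.1).eq, ← mul_assoc, ← mul_assoc]

lemma natCast_ne_zero_of_site [Nonempty (Config L d)] (l : Fin L) : (d : ℂ) ≠ 0 := by
  have := ((Classical.arbitrary (Config L d)) l).pos
  exact_mod_cast this.ne'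

lemma norm_siteAverage_le [Nonempty (Config L d)] (l : Fin L) (A : Op L d) :
    ‖siteAverage l A‖ ≤ ‖A‖ := by
  have hd := natCast_ne_zero_of_site (L := L) (d := d) l
  have hd' : (0 : ℝ) < d := by
    have : d ≠ 0 := by exact_mod_cast hd
    positivity
  have h := norm_sum_conjTranspose_mul_mul_le (fun q : Fin d × Fin d => siteUnit l q.2 q.1) A
    (s := d) hd'.le (by simpa [conjTranspose_siteUnit] using sum_siteUnit_mul_siteUnit (d := d) l)
  simp only [conjTranspose_siteUnit] at h
  rw [siteAverage, norm_smul, norm_inv, Complex.norm_natCast, inv_mul_le_iff₀ hd']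
  exact h

lemma trace_siteAverage [Nonempty (Config L d)] (l : Fin L) (A : Op L d) :
    (siteAverage l A).trace = A.trace := by
  have hd := natCast_ne_zero_of_site (L := L) (d := d) l
  have h1 : ∀ q : Fin d × Fin d, (siteUnit l q.1 q.2 * A * siteUnit l q.2 q.1).trace =
      (A * (siteUnit l q.2 q.1 * siteUnit l q.1 q.2)).trace := fun q => by
    rw [mul_assoc, Matrix.trace_mul_comm, mul_assoc]
  have h2 : ∑ q : Fin d × Fin d, siteUnit l q.2 q.1 * siteUnit l q.1 q.2 =
      (d : ℂ) • (1 : Op L d) := by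
    rw [← sum_siteUnit_mul_siteUnit l]
    exact (Equiv.prodComm (Fin d) (Fin d)).sum_comp
      fun q => siteUnit l q.1 q.2 * siteUnit l q.2 q.1
  rw [siteAverage, Matrix.trace_smul, Matrix.trace_sum, Finset.sum_congr rfl fun q _ => h1 q,
    ← Matrix.trace_sum, ← Finset.mul_sum, h2, mul_smul_comm, mul_one, Matrix.trace_smul,
    smul_smul, inv_mul_cancel₀ hd, one_smul]

/-- Because ∑ E_xy E_yx = d, the change under averaging consists of commutators with operators at
one site, which is what quasilocality of a Hamiltonian controls. -/
lemma sub_siteAverage [Nonempty (Config L d)] (l : Fin L) (A : Op L d) :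
    A - siteAverage l A = (d : ℂ)⁻¹ • ∑ q : Fin d × Fin d,
      (A * siteUnit l q.1 q.2 - siteUnit l q.1 q.2 * A) * siteUnit l q.2 q.1 := by
  have hd := natCast_ne_zero_of_site (L := L) (d := d) l
  simp only [sub_mul, Finset.sum_sub_distrib, smul_sub, mul_assoc A]
  rw [← Finset.mul_sum, sum_siteUnit_mul_siteUnit, mul_smul_comm, mul_one, smul_smul,
    inv_mul_cancel₀ hd, one_smul, siteAverage]

lemma LocalisedOn.siteAverage_erase {X : Finset (Fin L)} {A : Op L d} (hA : LocalisedOn X A)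
    (l : Fin L) : LocalisedOn (X.erase l) (siteAverage l A) := by
  obtain ⟨M, h1, h2⟩ := hA
  let ext : (↥(X.erase l) → Fin d) → Fin d → X → Fin d := fun σ y i =>
    if h : (i : Fin L) = l then y else σ ⟨i, Finset.mem_erase.2 ⟨h, i.2⟩⟩
  have hext : ∀ (σ : Config L d) (y : Fin d),
      (fun i : X => Function.update σ l y i) = ext (fun i => σ i) y := fun σ y => by
    funext i
    simp only [ext, Function.update_apply]
    split_ifs <;> rfl
  refine ⟨Matrix.of fun σ τ => (d : ℂ)⁻¹ * ∑ y, M (ext σ y) (ext τ y),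
    fun σ τ h => ?_, fun σ τ h => ?_⟩
  · rw [siteAverage_apply, if_pos (h l (Finset.notMem_erase l X)), Matrix.of_apply]
    congr 1
    refine Finset.sum_congr rfl fun y _ => ?_
    rw [h1, hext, hext]
    intro i hi
    by_cases hil : i = l
    · subst hil; simp
    · rw [Function.update_of_ne hil, Function.update_of_ne hil]
      exact h i fun hc => hi (Finset.mem_of_mem_erase hc)
  · obtain ⟨i, hi, hne⟩ := h
    rw [siteAverage_apply]
    split_ifs with hl
    · have hil : i ≠ l := by rintro rfl; exact hne hl
      rw [Finset.sum_eq_zero, mul_zero]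
      intro y _
      refine h2 _ _ ⟨i, fun hc => hi (Finset.mem_erase.2 ⟨hil, hc⟩), ?_⟩
      rwa [Function.update_of_ne hil, Function.update_of_ne hil]
    · rfl

/-- The average of an operator over the first `m` sites. -/
noncomputable def initAverage : ℕ → Op L d → Op L d
  | 0, A => A
  | m + 1, A => if h : m < L then siteAverage ⟨m, h⟩ (initAverage m A) else initAverage m A

lemma initAverage_succ (l : Fin L) (A : Op L d) :
    initAverage (l + 1) A = siteAverage l (initAverage l A) := by
  rw [initAverage, dif_pos l.2]

lemma initAverage_sub (m : ℕ) (A B : Op L d) :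
    initAverage m (A - B) = initAverage m A - initAverage m B := by
  induction m with
  | zero => rfl
  | succ m ih =>
    simp only [initAverage]
    split_ifs
    · rw [ih, siteAverage_sub]
    · exact ih

lemma norm_initAverage_le [Nonempty (Config L d)] (m : ℕ) (A : Op L d) :
    ‖initAverage m A‖ ≤ ‖A‖ := by
  induction m with
  | zero => exact le_rfl
  | succ m ih =>
    rw [initAverage]
    split_ifs
    · exact (norm_siteAverage_le _ _).trans ih
    · exact ih

lemma trace_initAverage [Nonempty (Config L d)] (m : ℕ) (A : Op L d) :
    (initAverage m A).trace = A.trace := by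
  induction m with
  | zero => rfl
  | succ m ih =>
    rw [initAverage]
    split_ifs
    · rw [trace_siteAverage, ih]
    · exact ih

lemma LocalisedOn.initAverage {X : Finset (Fin L)} {A : Op L d} (hA : LocalisedOn X A) (m : ℕ) :
    LocalisedOn X (initAverage m A) := by
  induction m with
  | zero => exact hA
  | succ m ih =>
    rw [SpinChain.initAverage]
    split_ifs
    · exact (ih.siteAverage_erase _).mono (Finset.erase_subset _ _)
    · exact ih

lemma localisedOn_univ (A : Op L d) : LocalisedOn Finset.univ A := by
  refine ⟨Matrix.of fun σ τ => A (fun i => σ ⟨i, by simp⟩) (fun i => τ ⟨i, by simp⟩),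
    fun σ τ _ => rfl, fun σ τ h => ?_⟩
  obtain ⟨i, hi, -⟩ := h
  exact absurd (Finset.mem_univ i) hi

lemma localisedOn_initAverage (m : ℕ) (A : Op L d) :
    LocalisedOn (Finset.univ.filter fun i : Fin L => m ≤ i) (initAverage m A) := by
  induction m with
  | zero => exact (localisedOn_univ A).mono (by simp)
  | succ m ih =>
    rw [initAverage]
    split_ifs with h
    · refine (ih.siteAverage_erase _).mono fun i hi => ?_
      simp only [Finset.mem_erase, Finset.mem_filter, Finset.mem_univ, true_and, ne_eq,
        Fin.ext_iff] at hi ⊢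
      omega
    · refine ih.mono fun i hi => ?_
      simp only [Finset.mem_filter, Finset.mem_univ, true_and] at hi
      have := i.2
      omega

/-- Only sites before `l` are averaged, and their matrix units commute with `B`. -/
lemma initAverage_commutator {m : ℕ} {l : Fin L} (hm : m ≤ l) {B : Op L d}
    (hB : LocalisedOn {l} B) (A : Op L d) :
    initAverage m (A * B - B * A) = initAverage m A * B - B * initAverage m A := by
  induction m with
  | zero => rfl
  | succ m ih =>
    have hmL : m < L := by have := l.2; omega
    have hc : ∀ x y, Commute (siteUnit ⟨m, hmL⟩ x y) B := fun x y =>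
      (localisedOn_siteUnit _ x y).commute hB (by
        rw [Finset.disjoint_singleton]
        intro h
        rw [← h] at hm
        simp at hm)
    rw [initAverage, dif_pos hmL, initAverage, dif_pos hmL, ih (by omega), siteAverage_sub,
      siteAverage_mul_right _ hc, siteAverage_mul_left _ hc]

/-! ### Energy densities of quasilocal Hamiltonians -/

/-- The energy density obtained by averaging over the sites one after the other. -/
noncomputable def averageDensity (H : Op L d) (l : Fin L) : Op L d :=
  initAverage l H - initAverage (l + 1) H

lemma averageDensity_eq [Nonempty (Config L d)] (H : Op L d) (l : Fin L) :
    averageDensity H l = (d : ℂ)⁻¹ • ∑ q : Fin d × Fin d,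
      initAverage l (H * siteUnit l q.1 q.2 - siteUnit l q.1 q.2 * H) * siteUnit l q.2 q.1 := by
  rw [averageDensity, initAverage_succ, sub_siteAverage]
  congr 1
  refine Finset.sum_congr rfl fun q _ => ?_
  rw [initAverage_commutator le_rfl (localisedOn_siteUnit l q.1 q.2)]

lemma trace_one_config : (1 : Op L d).trace = (d : ℂ) ^ L := by
  simp [Matrix.trace_one]

/-- The sum telescopes to `H` minus its average over all sites; that average is a scalar, identified
by its trace. -/
lemma eq_hamiltonian_averageDensity_add [Nonempty (Config L d)] (H : Op L d) :
    H = hamiltonian (averageDensity H) Finset.univ + (H.trace / (d : ℂ) ^ L) • 1 := by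
  have h1 : hamiltonian (averageDensity H) Finset.univ = H - initAverage L H := by
    have h2 := Fin.sum_univ_eq_sum_range
      (fun m => initAverage m H - initAverage (m + 1) H) L
    rw [Finset.sum_range_sub'] at h2
    exact h2
  have h2 : LocalisedOn ∅ (initAverage L H) := (localisedOn_initAverage L H).mono fun i hi => by
    have := i.2
    simp only [Finset.mem_filter, Finset.mem_univ, true_and] at hi
    omega
  obtain ⟨z, hz⟩ := h2.exists_eq_smul_one
  have h3 := trace_initAverage L H
  rw [hz, Matrix.trace_smul, trace_one_config, smul_eq_mul] at h3
  have hd : (d : ℂ) ^ L ≠ 0 := by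
    rw [← trace_one_config, Matrix.trace_one]
    exact_mod_cast Fintype.card_ne_zero
  rw [h1, hz, ← h3, mul_div_cancel_right₀ _ hd, sub_add_cancel]

/-- There are d² terms and a prefactor 1/d, hence the factor `d` in the amplitude of the density. -/
lemma norm_inv_smul_sum_mul_siteUnit_le [Nonempty (Config L d)] (l : Fin L)
    (F : Fin d × Fin d → Op L d) {C : ℝ} (hF : ∀ q, ‖F q‖ ≤ C) :
    ‖(d : ℂ)⁻¹ • ∑ q : Fin d × Fin d, F q * siteUnit l q.2 q.1‖ ≤ d * C := by
  have hd := natCast_ne_zero_of_site (L := L) (d := d) l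
  have hd' : (0 : ℝ) < d := by
    have : d ≠ 0 := by exact_mod_cast hd
    positivity
  rw [norm_smul, norm_inv, Complex.norm_natCast, inv_mul_le_iff₀ hd']
  refine (norm_sum_le _ _).trans ((Finset.sum_le_sum (g := fun _ => C) fun q _ => ?_).trans ?_)
  · refine (norm_mul_le _ _).trans ?_
    calc _ ≤ ‖F q‖ * 1 := by gcongr; exact norm_siteUnit_le _ _ _
      _ ≤ C := by rw [mul_one]; exact hF q
  · simp [mul_assoc]

lemma IsQuasilocal.isQuasilocalDensity [Nonempty (Config L d)] {b : Boundary} {J μ : ℝ}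
    {H : Op L d} (hH : IsQuasilocal b J μ H) :
    IsQuasilocalDensity b (d * |J|) μ (averageDensity H) := by
  have hJ : ∀ (l : Fin L) (q : Fin d × Fin d), J * ‖siteUnit l q.1 q.2‖ ≤ |J| := fun l q => by
    calc J * ‖siteUnit l q.1 q.2‖ ≤ |J| * 1 := by
          gcongr
          · exact le_abs_self J
          · exact norm_siteUnit_le _ _ _
      _ = |J| := mul_one _
  -- Converts an approximant of i[H, O] into one of [H, O] with the same error.
  have hI : ∀ A B : Op L d, ‖A - (-Complex.I) • B‖ = ‖Complex.I • A - B‖ := fun A B => by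
    have : Complex.I • A - B = Complex.I • (A - (-Complex.I) • B) := by
      rw [smul_sub, smul_smul]; simp
    rw [this, norm_smul, Complex.norm_I, one_mul]
  refine ⟨?_, fun l => ?_, fun l r => ?_⟩
  · have h1 := eq_hamiltonian_averageDensity_add H
    have h2 : ∑ l, averageDensity H l = H - (H.trace / (d : ℂ) ^ L) • 1 :=
      eq_sub_of_add_eq h1.symm
    rw [h2]
    refine hH.hermitian.sub ?_
    have h3 : star H.trace = H.trace := by
      rw [← Matrix.trace_conjTranspose, hH.hermitian.eq]
    unfold Matrix.IsHermitian
    rw [Matrix.conjTranspose_smul, Matrix.conjTranspose_one, star_div₀, h3, star_pow, star_natCast]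
  · rw [averageDensity_eq]
    refine norm_inv_smul_sum_mul_siteUnit_le l _ fun q => (norm_initAverage_le _ _).trans ?_
    have h1 := hH.bounded l _ (localisedOn_siteUnit l q.1 q.2)
    rw [norm_smul, Complex.norm_I, one_mul] at h1
    exact h1.trans (hJ l q)
  · choose B hB hBn using fun q : Fin d × Fin d =>
      hH.quasilocalised l _ (localisedOn_siteUnit l q.1 q.2) r
    refine ⟨(d : ℂ)⁻¹ • ∑ q : Fin d × Fin d,
      initAverage l ((-Complex.I) • B q) * siteUnit l q.2 q.1, ?_, ?_⟩
    · exact (LocalisedOn.sum _ fun q _ => (((hB q).smul _).initAverage _).mul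
        ((localisedOn_siteUnit l q.2 q.1).mono (subset_thicken b {l} r))).smul _
    · rw [averageDensity_eq, ← smul_sub, ← Finset.sum_sub_distrib]
      simp only [← sub_mul, ← initAverage_sub]
      rw [mul_assoc]
      refine norm_inv_smul_sum_mul_siteUnit_le l _ fun q => (norm_initAverage_le _ _).trans ?_
      rw [hI]
      exact (hBn q).trans (mul_le_mul_of_nonneg_right (hJ l q) (Real.exp_nonneg _))

/-- Extensivity of the energy cumulants of a quasilocal Hamiltonian. -/
theorem exists_norm_cumulant_sub_le (d : ℕ) (J μ c a ξ : ℝ) (hμ : 0 < μ) (hξ : 0 < ξ) (n : ℕ) :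
    ∃ K : ℝ, ∀ (b : Boundary) (L : ℕ) (H : Op L d) (ψ : StateVec L d),
      IsQuasilocal b J μ H → HasCorrelationLength b c a ξ ψ →
      ‖cumulant ψ H n - (if n = 1 then H.trace / (d : ℂ) ^ L else 0)‖ ≤ K * (L : ℝ) := by
  obtain ⟨K, hK⟩ := exists_norm_cumulant_le d (d * |J|) μ c a ξ hμ hξ n
  refine ⟨K, fun b L H ψ hH hψ => ?_⟩
  -- A unit vector exists only if there are configurations; this excludes d = 0 on a nonempty chain,
  -- where division by `d` would fail.
  have := nonempty_config hψ.normalised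
  have h1 := eq_hamiltonian_averageDensity_add H
  have h2 := cumulant_add_smul_one hψ.normalised (hamiltonian (averageDensity H) Finset.univ)
    (H.trace / (d : ℂ) ^ L) n
  rw [← h1] at h2
  rw [h2]
  exact hK b L _ ψ hH.isQuasilocalDensity hψ

end SpinChain

theorem mainTheorem4 (d : ℕ) (J μ c a ξ : ℝ) (hμ : 0 < μ) (hξ : 0 < ξ) :
    -- Extensivity of the energy cumulants, uniformly in the chain, the Hamiltonian and the state. A
    -- constant added to the Hamiltonian only shifts the first cumulant; it is fixed here by the trace.
    (∀ n : ℕ, ∃ K : ℝ, ∀ (b : SpinChain.Boundary) (L : ℕ) (H : SpinChain.Op L d)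
        (ψ : SpinChain.StateVec L d),
      SpinChain.IsQuasilocal b J μ H → SpinChain.HasCorrelationLength b c a ξ ψ →
      ‖SpinChain.cumulant ψ H n - (if n = 1 then H.trace / (d : ℂ) ^ L else 0)‖ ≤
        K * (L : ℝ)) ∧
    -- Extensivity of every cumulant, the first one included, for a sum of bounded energy densities.
    (∀ n : ℕ, ∃ K : ℝ, ∀ (b : SpinChain.Boundary) (L : ℕ) (h : Fin L → SpinChain.Op L d)
        (ψ : SpinChain.StateVec L d),
      SpinChain.IsQuasilocalDensity b J μ h → SpinChain.HasCorrelationLength b c a ξ ψ →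
      ‖SpinChain.cumulant ψ (SpinChain.hamiltonian h Finset.univ) n‖ ≤ K * (L : ℝ)) ∧
    -- The cumulants are sums over the sites of bounded cumulant densities.
    (∀ n : ℕ, 1 ≤ n → ∃ K : ℝ, ∀ (b : SpinChain.Boundary) (L : ℕ) (h : Fin L → SpinChain.Op L d)
        (ψ : SpinChain.StateVec L d),
      SpinChain.IsQuasilocalDensity b J μ h → SpinChain.HasCorrelationLength b c a ξ ψ →
      SpinChain.cumulant ψ (SpinChain.hamiltonian h Finset.univ) (n + 1) =
          ∑ l, SpinChain.connCorr ψ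
            (SpinChain.dressed ψ (SpinChain.hamiltonian h Finset.univ) n) (h l) ∧
        ∀ l, ‖SpinChain.connCorr ψ
            (SpinChain.dressed ψ (SpinChain.hamiltonian h Finset.univ) n) (h l)‖ ≤ K) ∧
    -- Connected correlations with a localised operator are exponentially close to truncated ones.
    (∀ n : ℕ, ∃ κ : ℝ, 0 < κ ∧ ∀ k : ℕ, ∃ K : ℝ,
      ∀ (b : SpinChain.Boundary) (L : ℕ) (h : Fin L → SpinChain.Op L d)
        (ψ : SpinChain.StateVec L d),
      SpinChain.IsQuasilocalDensity b J μ h → SpinChain.HasCorrelationLength b c a ξ ψ →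
      ∀ (Z S : Finset (Fin L)) (O : SpinChain.Op L d) (r : ℕ),
        SpinChain.LocalisedOn Z O → Z.card ≤ k → SpinChain.thicken b Z r ⊆ S →
        ‖SpinChain.connCorr ψ
              (SpinChain.dressed ψ (SpinChain.hamiltonian h Finset.univ) n) O -
            SpinChain.connCorr ψ
              (SpinChain.dressed ψ (SpinChain.hamiltonian h S) n) O‖ ≤
          K * ‖O‖ * Real.exp (-κ * (r : ℝ))) ∧
    -- The truncated operators are quasilocalised about the truncation region.
    (∀ n k : ℕ, ∃ K : ℝ, ∀ (b : SpinChain.Boundary) (L : ℕ) (h : Fin L → SpinChain.Op L d)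
        (ψ : SpinChain.StateVec L d),
      SpinChain.IsQuasilocalDensity b J μ h → SpinChain.HasCorrelationLength b c a ξ ψ →
      ∀ S : Finset (Fin L), S.card ≤ k →
        SpinChain.QuasilocalisedAbout b K μ S
          (SpinChain.dressed ψ (SpinChain.hamiltonian h S) n)) := by
  exact ⟨fun n => SpinChain.exists_norm_cumulant_sub_le d J μ c a ξ hμ hξ n,
    fun n => SpinChain.exists_norm_cumulant_le d J μ c a ξ hμ hξ n,
    fun n hn => SpinChain.exists_cumulant_eq_sum d J μ c a ξ hμ hξ n hn,
    fun n => SpinChain.exists_norm_connCorr_sub_le d J μ c a ξ hμ hξ n,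
    fun n k => SpinChain.exists_quasilocalisedAbout_dressed d J μ c a ξ hμ n k⟩
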